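/- Let $\Bbbk$ be an algebraically closed field and let $\mathscr{C}$ be a fiat $2$-category over $\Bbbk$. This means the following. $\mathscr{C}$ is a strict $2$-category with finitely many objects. Each category $\mathscr{C}(\mathtt{i},\mathtt{j})$ of $1$-morphisms is an idempotent complete additive $\Bbbk$-linear category with finite dimensional morphism spaces and finitely many isomorphism classes of indecomposable objects. Horizontal composition is biadditive, and all identity $1$-morphisms $\mathbb{1}_{\mathtt{i}}$ are indecomposable. Moreover, $\mathscr{C}$ has an involution $*$, that is, an object-preserving anti-automorphism which reverses $1$- and $2$-morphisms, is compatible with composition up to isomorphism and satisfies $\mathrm{F}^{**}\cong \mathrm{F}$, such that for every $\mathrm{F}\in\mathscr{C}(\mathtt{i},\mathtt{j})$ there are $2$-morphisms $\mathrm{F}\circ\mathrm{F}^*\to\mathbb{1}_{\mathtt{j}}$ and $\mathbb{1}_{\mathtt{i}}\to\mathrm{F}^*\circ\mathrm{F}$ making $(\mathrm{F},\mathrm{F}^*)$ an adjoint pair. A $2$-representation of $\mathscr{C}$ is a strict $2$-functor from $\mathscr{C}$ to the $2$-category of categories equivalent to $A\text{-}\mathrm{mod}$, the finite dimensional modules over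 some finite dimensional $\Bbbk$-algebra $A$, with all functors and natural transformations. For an object $\mathtt{i}$ let $\mathbf{P}_{\mathtt{i}}$ be the $\mathtt{i}$-th principal $2$-representation: the objects of $\mathbf{P}_{\mathtt{i}}(\mathtt{j})$ are diagrams $\mathrm{F}\xrightarrow{\alpha}\mathrm{G}$ in $\mathscr{C}(\mathtt{i},\mathtt{j})$, its morphisms from $\alpha$ to $\alpha'\colon \mathrm{F}'\to \mathrm{G}'$ are commutative squares $(\beta\colon \mathrm{F}\to\mathrm{F}',\ \beta'\colon \mathrm{G}\to\mathrm{G}')$ modulo those for which there is $\xi\colon\mathrm{G}\to\mathrm{F}'$ with $\alpha'\xi=\beta'$, and $\mathscr{C}$ acts by left horizontal composition. Put $P_{\mathrm{F}}=(0\to\mathrm{F})$ and, for $\mathrm{F}$ indecomposable, let $L_{\mathrm{F}}$ be the simple top of $P_{\mathrm{F}}$. For indecomposable $1$-morphisms $\mathrm{F},\mathrm{G}$ with source $\mathtt{i}$ write $\mathrm{F}\leq_R\mathrm{G}$ if $\mathrm{G}$ is a direct summand of $\mathrm{H}\circ\mathrm{F}$ for some $1$-morphism $\mathrm{H}$; a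 right cell is an equivalence class for the equivalence relation defined by this preorder. Let $\mathcal{R}$ be a right cell consisting of $1$-morphisms with source $\mathtt{i}$. Then there is a unique submodule $K_{\mathcal{R}}$ of $P_{\mathbb{1}_{\mathtt{i}}}$ such that every simple subquotient of $P_{\mathbb{1}_{\mathtt{i}}}/K_{\mathcal{R}}$ is annihilated by all $\mathrm{F}\in\mathcal{R}$, and such that $K_{\mathcal{R}}$ has simple top $L:=L_{\mathrm{G}_{\mathcal{R}}}$ for some indecomposable $\mathrm{G}_{\mathcal{R}}$, with $\mathrm{F}\,L\neq 0$ for all $\mathrm{F}\in\mathcal{R}$. For every object $\mathtt{j}$ let $\mathbf{C}_{\mathcal{R}}(\mathtt{j})$ be the full subcategory of $\mathbf{P}_{\mathtt{i}}(\mathtt{j})$ consisting of all $M$ that admit a two-step presentation $X_1\to X_0\twoheadrightarrow M\to 0$ in which $X_1$ and $X_0$ are direct summands of finite direct sums of modules $\mathrm{F}\,L$ with $\mathrm{F}\in\mathcal{R}$, $\mathrm{F}\colon\mathtt{i}\to\mathtt{j}$. Then $\mathrm{F}\,\mathbf{C}_{\mathcal{R}}(\mathtt{j})\subset\mathbf{C}_{\mathcal{R}}(\mathtt{k})$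 for every $1$-morphism $\mathrm{F}\colon\mathtt{j}\to\mathtt{k}$, each $\mathbf{C}_{\mathcal{R}}(\mathtt{j})$ is $\Bbbk$-linearly equivalent to the category of finite dimensional modules over a finite dimensional $\Bbbk$-algebra, and restriction from $\mathbf{P}_{\mathtt{i}}$ therefore defines the structure of a $2$-representation of $\mathscr{C}$ on $\mathbf{C}_{\mathcal{R}}$. -/

import Mathlib

open CategoryTheory Limits Bicategory Opposite ZeroObject

universe w v u w' v' uk

noncomputable section

namespace CellTwoRep

/-! ### The abelianisation of an additive category by diagrams `X ⟶ Y` -/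

section Freyd

variable (A : Type v) [Category.{w} A] [Preadditive A]

/-- Two commutative squares `(β, β')` and `(γ, γ')` between diagrams `α : F ⟶ G` and
`α' : F' ⟶ G'` are identified when `β' - γ'` factors as `ξ ≫ α'` for some `ξ : G ⟶ F'`. -/
def freydRel : HomRel (Arrow A) := fun X Y f g =>
  ∃ ξ : X.right ⟶ Y.left, ξ ≫ Y.hom = f.right - g.right

instance : Congruence (freydRel A) where
  comp_left := by
    rintro X Y Z f g g' ⟨ξ, h⟩
    refine ⟨f.right ≫ ξ, ?_⟩
    simp [h]
  comp_right := by
    rintro X Y Z f f' g ⟨ξ, h⟩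
    refine ⟨ξ ≫ g.left, ?_⟩
    have := Arrow.w g
    rw [Category.assoc, this, ← Category.assoc, h]
    simp
  equivalence := by
    intro X Y
    refine ⟨fun f => ⟨0, by simp⟩, ?_, ?_⟩
    · rintro f g ⟨ξ, h⟩
      exact ⟨-ξ, by simp [h]⟩
    · rintro f g l ⟨ξ, h⟩ ⟨ξ', h'⟩
      exact ⟨ξ + ξ', by simp [h, h']⟩

/-- Objects are diagrams `α : F ⟶ G` in `A`; morphisms are commutative squares modulo the ideal
of squares `(β, β')` for which there is `ξ` with `ξ ≫ α' = β'`. -/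
abbrev Freyd := CategoryTheory.Quotient (freydRel A)

instance : Preadditive (Freyd A) :=
  CategoryTheory.Quotient.preadditive (freydRel A) (by
    rintro X Y f₁ f₂ g₁ g₂ ⟨ξ, h⟩ ⟨ξ', h'⟩
    exact ⟨ξ + ξ', by simp [h, h']; abel⟩)

instance : (CategoryTheory.Quotient.functor (freydRel A)).Additive :=
  CategoryTheory.Quotient.functor_additive _ _

section Linear

variable (k : Type uk) [Field k] [Linear k A]

instance (X Y : Arrow A) : Module k (X ⟶ Y) where
  smul c f := Arrow.homMk (c • f.left) (c • f.right) (by simp [Arrow.w])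
  one_smul f := by ext <;> exact one_smul _ _
  mul_smul a b f := by ext <;> exact mul_smul _ _ _
  smul_zero a := by ext <;> exact smul_zero _
  smul_add a f g := by ext <;> exact smul_add _ _ _
  add_smul a b f := by ext <;> exact add_smul _ _ _
  zero_smul f := by ext <;> exact zero_smul _ _

instance : Linear k (Arrow A) where
  smul_comp X Y Z c f g := by ext <;> exact Linear.smul_comp _ _ _ _ _ _
  comp_smul X Y Z f c g := by ext <;> exact Linear.comp_smul _ _ _ _ _ _

instance : Linear k (Freyd A) :=
  CategoryTheory.Quotient.linear k (freydRel A) (by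
    rintro c X Y f g ⟨ξ, h⟩
    refine ⟨c • ξ, ?_⟩
    rw [Linear.smul_comp, h, smul_sub]
    rfl)

end Linear

variable {A}

/-- The object `0 ⟶ F`. -/
def Freyd.proj [HasZeroObject A] (F : A) : Freyd A :=
  (CategoryTheory.Quotient.functor (freydRel A)).obj
    (Arrow.mk (0 : (0 : A) ⟶ F))

variable {B : Type v} [Category.{w} B] [Preadditive B]
  {D : Type v} [Category.{w} D] [Preadditive D]

/-- Componentwise application of an additive functor to diagrams. -/
def Freyd.map (F : A ⥤ B) [F.Additive] : Freyd A ⥤ Freyd B :=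
  CategoryTheory.Quotient.lift _ (F.mapArrow ⋙ CategoryTheory.Quotient.functor (freydRel B)) (by
    rintro X Y f g ⟨ξ, h⟩
    apply CategoryTheory.Quotient.sound
    refine ⟨F.map ξ, ?_⟩
    change F.map ξ ≫ F.map Y.hom = F.map f.right - F.map g.right
    rw [← F.map_comp, h, F.map_sub])

/-- Componentwise application of a natural transformation to diagrams. -/
def Freyd.mapNat {F G : A ⥤ B} [F.Additive] [G.Additive] (η : F ⟶ G) :
    Freyd.map F ⟶ Freyd.map G :=
  CategoryTheory.Quotient.natTransLift _
    (Functor.whiskerRight ((Functor.mapArrowFunctor A B).map η)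
      (CategoryTheory.Quotient.functor (freydRel B)))

lemma Freyd.map_congr {F G : A ⥤ B} [F.Additive] [G.Additive] (h : F = G) :
    Freyd.map F = Freyd.map G := by
  subst h; rfl

lemma Freyd.map_id : Freyd.map (𝟭 A) = 𝟭 (Freyd A) :=
  CategoryTheory.Quotient.lift_unique' _ _ _ rfl

lemma Freyd.map_comp (F : A ⥤ B) (G : B ⥤ D) [F.Additive] [G.Additive] :
    Freyd.map (F ⋙ G) = Freyd.map F ⋙ Freyd.map G :=
  CategoryTheory.Quotient.lift_unique' _ _ _ rfl

lemma Freyd.mapNat_id (F : A ⥤ B) [F.Additive] :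
    Freyd.mapNat (𝟙 F) = 𝟙 (Freyd.map F) := by
  apply CategoryTheory.Quotient.natTrans_ext
  ext X
  rfl

lemma Freyd.mapNat_comp {F G H : A ⥤ B} [F.Additive] [G.Additive] [H.Additive]
    (η : F ⟶ G) (θ : G ⟶ H) :
    Freyd.mapNat (η ≫ θ) = Freyd.mapNat η ≫ Freyd.mapNat θ := by
  apply CategoryTheory.Quotient.natTrans_ext
  ext X
  rfl

lemma Freyd.mapNat_eqToHom {F G : A ⥤ B} [F.Additive] [G.Additive] (h : F = G) :
    Freyd.mapNat (eqToHom h) = eqToHom (Freyd.map_congr h) := by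
  subst h
  exact Freyd.mapNat_id F

lemma Freyd.mapNat_whiskerLeft (F : A ⥤ B) {G H : B ⥤ D} [F.Additive] [G.Additive] [H.Additive]
    (η : G ⟶ H) :
    Freyd.mapNat (Functor.whiskerLeft F η) =
      eqToHom (Freyd.map_comp F G) ≫ Functor.whiskerLeft (Freyd.map F) (Freyd.mapNat η) ≫
        eqToHom (Freyd.map_comp F H).symm := by
  apply CategoryTheory.Quotient.natTrans_ext
  ext X
  simp only [NatTrans.comp_app, eqToHom_app, Functor.whiskerLeft_app]
  exact ((Category.id_comp _).trans (Category.comp_id _)).symm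

lemma Freyd.mapNat_whiskerRight {F G : A ⥤ B} (η : F ⟶ G) (H : B ⥤ D)
    [F.Additive] [G.Additive] [H.Additive] :
    Freyd.mapNat (Functor.whiskerRight η H) =
      eqToHom (Freyd.map_comp F H) ≫ Functor.whiskerRight (Freyd.mapNat η) (Freyd.map H) ≫
        eqToHom (Freyd.map_comp G H).symm := by
  apply CategoryTheory.Quotient.natTrans_ext
  ext X
  simp only [NatTrans.comp_app, eqToHom_app, Functor.whiskerLeft_app, Functor.whiskerRight_app]
  exact ((Category.id_comp _).trans (Category.comp_id _)).symm

end Freyd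

/-! ### Finitary and fiat 2-categories -/

section TwoCat

variable (C : Type u) [Bicategory.{w, v} C] [∀ a b : C, Preadditive (a ⟶ b)]

/-- The categories of 1-morphisms are additive and idempotent complete, and horizontal
composition is biadditive. -/
class IsAdditiveTwoCategory : Prop where
  hasFiniteBiproducts (a b : C) : HasFiniteBiproducts (a ⟶ b)
  isIdempotentComplete (a b : C) : IsIdempotentComplete (a ⟶ b)
  whiskerLeft_add {a b c : C} (F : a ⟶ b) {G H : b ⟶ c} (α β : G ⟶ H) :
    F ◁ (α + β) = F ◁ α + F ◁ β
  add_whiskerRight {a b c : C} {F G : a ⟶ b} (α β : F ⟶ G) (H : b ⟶ c) :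
    (α + β) ▷ H = α ▷ H + β ▷ H

instance (a b : C) [IsAdditiveTwoCategory C] : HasFiniteBiproducts (a ⟶ b) :=
  IsAdditiveTwoCategory.hasFiniteBiproducts a b

instance (a b : C) [IsAdditiveTwoCategory C] : HasBinaryBiproducts (a ⟶ b) :=
  hasBinaryBiproducts_of_finite_biproducts _

instance (a b : C) [IsAdditiveTwoCategory C] : HasZeroObject (a ⟶ b) :=
  inferInstance

/-- `k`-finitary 2-categories (for a strict bicategory `C`). -/
structure IsFinitary (k : Type uk) [Field k] [∀ a b : C, Linear k (a ⟶ b)] [IsAdditiveTwoCategory C] :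
    Prop where
  finite_obj : Finite C
  finite_hom {a b : C} (F G : a ⟶ b) : Module.Finite k (F ⟶ G)
  finite_indecomposable (a b : C) : ∃ T : Set (a ⟶ b), T.Finite ∧
    ∀ F : a ⟶ b, Indecomposable F → ∃ G ∈ T, Nonempty (F ≅ G)
  indecomposable_id (a : C) : Indecomposable (𝟙 a)

/-- An involution: the identity on objects, reversing 1-morphisms and 2-morphisms, compatible with
identities and composition up to (natural) isomorphism, and involutive up to isomorphism. -/
structure Involution where
  star {a b : C} : (a ⟶ b)ᵒᵖ ⥤ (b ⟶ a)
  starId (a : C) : star.obj (op (𝟙 a)) ≅ 𝟙 a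
  starComp {a b c : C} (F : a ⟶ b) (G : b ⟶ c) :
    star.obj (op (F ≫ G)) ≅ star.obj (op G) ≫ star.obj (op F)
  starComp_naturality {a b c : C} {F F' : a ⟶ b} {G G' : b ⟶ c} (α : F ⟶ F') (β : G ⟶ G') :
    star.map (α ▷ G ≫ F' ◁ β).op ≫ (starComp F G).hom =
      (starComp F' G').hom ≫ star.map β.op ▷ star.obj (op F') ≫
        star.obj (op G) ◁ star.map α.op
  starStar {a b : C} (F : a ⟶ b) : Nonempty (star.obj (op (star.obj (op F))) ≅ F)

/-- There are an involution `*` and, for every 1-morphism `F : a ⟶ b`, adjunction morphisms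
`F ∘ F* ⟶ 𝟙 b` and `𝟙 a ⟶ F* ∘ F`. -/
def HasInvolutionWithAdjunctions : Prop :=
  ∃ I : Involution C, ∀ ⦃a b : C⦄ (F : a ⟶ b),
    Nonempty (Bicategory.Adjunction F (I.star.obj (op F)))

/-- Fiat 2-categories. -/
structure IsFiat (k : Type uk) [Field k] [∀ a b : C, Linear k (a ⟶ b)] [IsAdditiveTwoCategory C] :
    Prop extends IsFinitary C k where
  involution : HasInvolutionWithAdjunctions C

end TwoCat

/-! ### 2-representations -/

section TwoRep

/-- `D` is equivalent to the category of finitely generated (equivalently, finite dimensional)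
left modules over a finite dimensional `k`-algebra. -/
def IsModuleCategory (k : Type uk) [Field k] (D : Type v') [Category.{w'} D] : Prop :=
  ∃ (R : Type w') (_ : Ring R) (_ : Algebra k R), Module.Finite k R ∧
    Nonempty (D ≌ FGModuleCat.{w'} R)

/-- As before, with a `k`-linear equivalence. -/
def IsLinearModuleCategory (k : Type uk) [Field k] (D : Type v') [Category.{w'} D] [Preadditive D]
    [Linear k D] : Prop :=
  ∃ (R : Type w') (_ : Ring R) (_ : Algebra k R), Module.Finite k R ∧
    ∃ (e : D ≌ FGModuleCat.{w'} R) (_ : e.functor.Additive), e.functor.Linear k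

variable {C : Type u} [Bicategory.{w, v} C]

/-- A strict 2-functor from `C` to categories is a 2-representation if its values are categories
equivalent to module categories of finite dimensional algebras. -/
def IsTwoRepresentation (k : Type uk) [Field k] (M : StrictPseudofunctor C Cat.{w', v'}) : Prop :=
  ∀ a : C, IsModuleCategory k (M.obj a)

/-- A family of full subcategories of the values of `M` which is preserved by the action of all
1-morphisms. -/
def IsStable (M : StrictPseudofunctor C Cat.{w', v'}) (S : ∀ a : C, ObjectProperty (M.obj a)) :
    Prop :=
  ∀ ⦃a b : C⦄ (F : a ⟶ b) (X : M.obj a), S a X → S b ((M.map F).toFunctor.obj X)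

section Restrict

variable {D E : Type v'} [Category.{w'} D] [Category.{w'} E]

/-- The restriction of a functor to full subcategories. -/
def restrictFunctor (F : D ⥤ E) (P : ObjectProperty D) (Q : ObjectProperty E)
    (h : ∀ X, P X → Q (F.obj X)) : P.FullSubcategory ⥤ Q.FullSubcategory :=
  Q.lift (P.ι ⋙ F) (fun X => h X.obj X.property)

/-- The restriction of a natural transformation to full subcategories. -/
def restrictNat {F G : D ⥤ E} (η : F ⟶ G) (P : ObjectProperty D) (Q : ObjectProperty E)
    (h : ∀ X, P X → Q (F.obj X)) (h' : ∀ X, P X → Q (G.obj X)) :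
    restrictFunctor F P Q h ⟶ restrictFunctor G P Q h' where
  app X := ObjectProperty.homMk (η.app X.obj)
  naturality X Y f := by
    apply ObjectProperty.hom_ext
    exact η.naturality f.hom

lemma restrictFunctor_congr {F G : D ⥤ E} (e : F = G) (P : ObjectProperty D)
    (Q : ObjectProperty E) (h : ∀ X, P X → Q (F.obj X)) (h' : ∀ X, P X → Q (G.obj X)) :
    restrictFunctor F P Q h = restrictFunctor G P Q h' := by
  subst e; rfl

lemma restrict_aux {P : ObjectProperty D} {X Y Z W : P.FullSubcategory} (e : X = Y) (f : Y ⟶ Z)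
    (e' : Z = W) : (eqToHom e ≫ f ≫ eqToHom e').hom =
      eqToHom (congrArg ObjectProperty.FullSubcategory.obj e) ≫ f.hom ≫
        eqToHom (congrArg ObjectProperty.FullSubcategory.obj e') := by
  subst e e'
  simp

end Restrict

/-- The restriction of `M.map F` to a stable family of full subcategories. -/
def restrictMap (M : StrictPseudofunctor C Cat.{w', v'})
    (S : ∀ a : C, ObjectProperty (M.obj a)) (h : IsStable M S) {a b : C} (F : a ⟶ b) :
    Cat.of (S a).FullSubcategory ⟶ Cat.of (S b).FullSubcategory :=
  (restrictFunctor (M.map F).toFunctor (S a) (S b) (h F)).toCatHom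

lemma restrictMap_comp (M : StrictPseudofunctor C Cat.{w', v'})
    (S : ∀ a : C, ObjectProperty (M.obj a)) (h : IsStable M S) {a b c : C} (F : a ⟶ b)
    (G : b ⟶ c) : restrictMap M S h (F ≫ G) = restrictMap M S h F ≫ restrictMap M S h G := by
  ext1
  exact restrictFunctor_congr (congrArg Cat.Hom.toFunctor (M.map_comp F G)) (S a) (S c)
    (h (F ≫ G)) (fun X hX => h G _ (h F X hX))

/-- The restriction of a strict 2-functor to a stable family of full subcategories. -/
def restrict [Bicategory.Strict C] (M : StrictPseudofunctor C Cat.{w', v'})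
    (S : ∀ a : C, ObjectProperty (M.obj a)) (h : IsStable M S) :
    StrictPseudofunctor C Cat.{w', v'} :=
  StrictPseudofunctor.mk''
    { obj a := Cat.of (S a).FullSubcategory
      map F := restrictMap M S h F
      map₂ {a b F G} η :=
        (restrictNat (M.map₂ η).toNatTrans (S a) (S b) (h F) (h G)).toCatHom₂
      map₂_id {a b} F := by
        ext X
        simp
        rfl
      map₂_comp {a b F G H} η θ := by
        ext X
        simp
        rfl
      map_id a := by
        ext1
        exact restrictFunctor_congr (congrArg Cat.Hom.toFunctor (M.map_id a)) (S a) (S a) (h (𝟙 a))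
          (fun _ hX => hX)
      map_comp F G := restrictMap_comp M S h F G
      map₂_whisker_left {a b c} F {G H} η := by
        ext X
        apply ObjectProperty.hom_ext
        have e := congrArg (fun t => t.toNatTrans.app X.obj) (M.map₂_whisker_left F η)
        simp only [M.mapComp_eq_eqToIso, eqToIso.hom, eqToIso.inv, Cat.Hom.toNatTrans_comp,
          NatTrans.comp_app, Cat.eqToHom_app] at e ⊢
        exact e.trans (restrict_aux (P := S c)
          (X := (restrictFunctor (M.map (F ≫ G)).toFunctor (S a) (S c) (h _)).obj X)
          (W := (restrictFunctor (M.map (F ≫ H)).toFunctor (S a) (S c) (h _)).obj X)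
          (congrArg (fun K => K.toFunctor.obj X) (restrictMap_comp M S h F G))
          ((restrictNat (M.map₂ η).toNatTrans (S b) (S c) (h G) (h H)).app
            ((restrictFunctor (M.map F).toFunctor (S a) (S b) (h F)).obj X))
          (congrArg (fun K => K.toFunctor.obj X) (restrictMap_comp M S h F H).symm)).symm
      map₂_whisker_right {a b c F G} η H := by
        ext X
        apply ObjectProperty.hom_ext
        have e := congrArg (fun t => t.toNatTrans.app X.obj) (M.map₂_whisker_right η H)
        simp only [M.mapComp_eq_eqToIso, eqToIso.hom, eqToIso.inv, Cat.Hom.toNatTrans_comp,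
          NatTrans.comp_app, Cat.eqToHom_app] at e ⊢
        exact e.trans (restrict_aux (P := S c)
          (X := (restrictFunctor (M.map (F ≫ H)).toFunctor (S a) (S c) (h _)).obj X)
          (W := (restrictFunctor (M.map (G ≫ H)).toFunctor (S a) (S c) (h _)).obj X)
          (congrArg (fun K => K.toFunctor.obj X) (restrictMap_comp M S h F H))
          ((restrictFunctor (M.map H).toFunctor (S b) (S c) (h H)).map
            ((restrictNat (M.map₂ η).toNatTrans (S a) (S b) (h F) (h G)).app X))
          (congrArg (fun K => K.toFunctor.obj X) (restrictMap_comp M S h G H).symm)).symm }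

end TwoRep

/-! ### Principal 2-representations -/

section Principal

lemma eqToHom_aux {D : Type v} [Category.{w} D] {X Y Z W : D} (e₁ : X = Y) (e₂ : Y = X)
    (f : X ⟶ Z) (e₃ : Z = W) (e₄ : W = Z) :
    f = eqToHom e₁ ≫ eqToHom e₂ ≫ f ≫ eqToHom e₃ ≫ eqToHom e₄ := by
  simp

lemma postcomp_id {C : Type u} [Bicategory.{w, v} C] [Bicategory.Strict C] (i a : C) : postcomp i (𝟙 a) = 𝟭 (i ⟶ a) :=
  CategoryTheory.Functor.ext (fun X => Strict.comp_id X) (fun X Y f => by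
    simp [Strict.rightUnitor_eqToIso]
    rfl)

lemma postcomp_comp {C : Type u} [Bicategory.{w, v} C] [Bicategory.Strict C] (i : C) {a b c : C} (F : a ⟶ b) (G : b ⟶ c) :
    postcomp i (F ≫ G) = postcomp i F ⋙ postcomp i G :=
  CategoryTheory.Functor.ext (fun X => (Strict.assoc X F G).symm) (fun X Y f => by
    change f ▷ (F ≫ G) = eqToHom _ ≫ (f ▷ F) ▷ G ≫ eqToHom _
    simp [Strict.associator_eqToIso])

variable {C : Type u} [Bicategory.{w, v} C] [∀ a b : C, Preadditive (a ⟶ b)] [IsAdditiveTwoCategory C]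

instance {a b : C} (i : C) (F : a ⟶ b) : (postcomp i F).Additive where
  map_add := IsAdditiveTwoCategory.add_whiskerRight _ _ _

/-- The action of `F : a ⟶ b` on diagrams: left horizontal composition with `F`. -/
def act (i : C) {a b : C} (F : a ⟶ b) : Freyd (i ⟶ a) ⥤ Freyd (i ⟶ b) :=
  Freyd.map (postcomp i F)

/-- The natural transformation with components `X ◁ η`. -/
def postcompNat (i : C) {a b : C} {F G : a ⟶ b} (η : F ⟶ G) : postcomp i F ⟶ postcomp i G where
  app X := X ◁ η
  naturality _ _ f := (whisker_exchange f η).symm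

/-- The natural transformation given by left horizontal composition with a 2-morphism. -/
def actNat (i : C) {a b : C} {F G : a ⟶ b} (η : F ⟶ G) : act i F ⟶ act i G :=
  Freyd.mapNat (postcompNat i η)

/-- The `i`-th principal 2-representation. -/
def principal [Bicategory.Strict C] (i : C) : StrictPseudofunctor C Cat.{w, max v w} :=
  StrictPseudofunctor.mk''
    { obj a := Cat.of (Freyd (i ⟶ a))
      map F := (act i F).toCatHom
      map₂ η := (actNat i η).toCatHom₂
      map₂_id {a b} F := by
        apply Cat.Hom₂.ext
        have e : postcompNat i (𝟙 F) = 𝟙 _ := by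
          ext X
          exact whiskerLeft_id X F
        exact (congrArg Freyd.mapNat e).trans (Freyd.mapNat_id _)
      map₂_comp {a b F G H} η θ := by
        apply Cat.Hom₂.ext
        have e : postcompNat i (η ≫ θ) = postcompNat i η ≫ postcompNat i θ := by
          ext X
          exact whiskerLeft_comp X η θ
        exact (congrArg Freyd.mapNat e).trans (Freyd.mapNat_comp _ _)
      map_id a := by
        ext1
        exact (Freyd.map_congr (postcomp_id i a)).trans Freyd.map_id
      map_comp {a b c} F G := by
        ext1
        exact (Freyd.map_congr (postcomp_comp i F G)).trans (Freyd.map_comp _ _)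
      map₂_whisker_left {a b c} F {G H} η := by
        apply Cat.Hom₂.ext
        have e : postcompNat i (F ◁ η) = eqToHom (postcomp_comp i F G) ≫
            Functor.whiskerLeft (postcomp i F) (postcompNat i η) ≫
              eqToHom (postcomp_comp i F H).symm := by
          ext X
          simp only [postcompNat, eqToHom_app, NatTrans.comp_app, Functor.whiskerLeft_app]
          change _ = eqToHom _ ≫ (X ≫ F) ◁ η ≫ eqToHom _
          simp only [comp_whiskerLeft, Strict.associator_eqToIso, eqToIso.hom,
            eqToIso.inv, Category.assoc]
          exact eqToHom_aux _ _ _ _ _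
        have e' := congrArg Freyd.mapNat e
        rw [Freyd.mapNat_comp, Freyd.mapNat_comp, Freyd.mapNat_eqToHom, Freyd.mapNat_eqToHom,
          Freyd.mapNat_whiskerLeft] at e'
        simp only [Cat.Hom.toNatTrans_comp, Cat.Hom₂.eqToHom_toNatTrans]
        refine e'.trans ?_
        simp only [Category.assoc, eqToHom_trans, eqToHom_trans_assoc]
        rfl
      map₂_whisker_right {a b c F G} η H := by
        apply Cat.Hom₂.ext
        have e : postcompNat i (η ▷ H) = eqToHom (postcomp_comp i F H) ≫
            Functor.whiskerRight (postcompNat i η) (postcomp i H) ≫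
              eqToHom (postcomp_comp i G H).symm := by
          ext X
          simp only [postcompNat, eqToHom_app, NatTrans.comp_app, Functor.whiskerRight_app]
          change _ = eqToHom _ ≫ (X ◁ η) ▷ H ≫ eqToHom _
          simp only [whisker_assoc, Strict.associator_eqToIso, eqToIso.hom,
            eqToIso.inv, Category.assoc]
          exact eqToHom_aux _ _ _ _ _
        have e' := congrArg Freyd.mapNat e
        rw [Freyd.mapNat_comp, Freyd.mapNat_comp, Freyd.mapNat_eqToHom, Freyd.mapNat_eqToHom,
          Freyd.mapNat_whiskerRight] at e'
        simp only [Cat.Hom.toNatTrans_comp, Cat.Hom₂.eqToHom_toNatTrans]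
        refine e'.trans ?_
        simp only [Category.assoc, eqToHom_trans, eqToHom_trans_assoc]
        rfl }

end Principal

/-! ### Simple tops, subquotients and presentations -/

section Modules

variable {D : Type v} [Category.{w} D]

/-- `X` has a simple top, isomorphic to `S`: `S` is simple and `X` has a quotient map to `S` which
is, up to isomorphism, its only simple quotient map. -/
def HasSimpleTop (X S : D) [HasZeroMorphisms D] : Prop :=
  Simple S ∧ ∃ p : X ⟶ S, Epi p ∧
    ∀ (T : D) (q : X ⟶ T), Simple T → Epi q → ∃ e : S ≅ T, p ≫ e.hom = q

/-- `S` is a simple subquotient of `X`, that is, a simple quotient of a subobject of `X`. -/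
def IsSimpleSubquotient [HasZeroMorphisms D] (S X : D) : Prop :=
  Simple S ∧ ∃ (Y : D) (m : Y ⟶ X) (p : Y ⟶ S), Mono m ∧ Epi p

/-- `p` is a cokernel of `f`, that is, `X ⟶ Y ↠ Z` is a presentation of `Z`. -/
def IsCokernelOf [HasZeroMorphisms D] {X Y Z : D} (f : X ⟶ Y) (p : Y ⟶ Z) : Prop :=
  ∃ w : f ≫ p = 0, Nonempty (IsColimit (CokernelCofork.ofπ p w))

/-- Direct summands of finite direct sums of objects satisfying `Q`. -/
def addClosure [HasZeroMorphisms D] (Q : ObjectProperty D) : ObjectProperty D := fun X =>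
  ∃ (n : ℕ) (Y : Fin n → D) (b : Bicone Y),
    (∀ t, Q (Y t)) ∧ Nonempty b.IsBilimit ∧ Nonempty (Retract X b.pt)

/-- Objects `M` with a two-step presentation `X₁ ⟶ X₀ ↠ M` where `X₁, X₀` belong to the additive
closure of `Q`. -/
def presentedBy [HasZeroMorphisms D] (Q : ObjectProperty D) : ObjectProperty D := fun M =>
  ∃ (X₁ X₀ : D) (d : X₁ ⟶ X₀) (p : X₀ ⟶ M),
    addClosure Q X₁ ∧ addClosure Q X₀ ∧ IsCokernelOf d p

end Modules

/-! ### Right cells and cell 2-representations -/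

section Cells

variable {C : Type u} [Bicategory.{w, v} C] [∀ a b : C, Preadditive (a ⟶ b)]
  [IsAdditiveTwoCategory C]

/-- The right preorder: `G` is a direct summand of `H ∘ F` for some 1-morphism `H`. -/
def RightLE {i a b : C} (F : i ⟶ a) (G : i ⟶ b) : Prop :=
  ∃ (H : a ⟶ b) (Z : i ⟶ b), Nonempty (F ≫ H ≅ G ⊞ Z)

/-- Right cells of indecomposable 1-morphisms with source `i`; `R a` is the set of members with
target `a`. (Members are not restricted to a set of representatives of isomorphism classes.) -/
def IsRightCell {i : C} (R : ∀ a : C, Set (i ⟶ a)) : Prop :=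
  ∃ (b : C) (F : i ⟶ b), Indecomposable F ∧
    ∀ (a : C) (G : i ⟶ a), G ∈ R a ↔ Indecomposable G ∧ RightLE F G ∧ RightLE G F

/-- `L` is the simple top `L_G` of the indecomposable projective `P_G`. -/
def IsSimpleOf {i a : C} (G : i ⟶ a) (L : Freyd (i ⟶ a)) : Prop :=
  Indecomposable G ∧ HasSimpleTop (Freyd.proj G) L

/-- The characterisation of `K_R`, `G_R` and `L = L_{G_R}`: every simple subquotient of
`P_{𝟙 i} / K` is annihilated by all `F ∈ R`, and `K` has simple top `L = L_G`, which is annihilated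
by no `F ∈ R`. -/
structure IsCellDatum {i : C} (R : ∀ a : C, Set (i ⟶ a)) (K : Subobject (Freyd.proj (𝟙 i)))
    (G : i ⟶ i) (L : Freyd (i ⟶ i)) : Prop where
  annihilates : ∀ (Q : Freyd (i ⟶ i)) (q : Freyd.proj (𝟙 i) ⟶ Q), IsCokernelOf K.arrow q →
    ∀ S, IsSimpleSubquotient S Q → ∀ (a : C), ∀ F ∈ R a, IsZero ((act i F).obj S)
  isSimpleOf : IsSimpleOf G L
  hasSimpleTop : HasSimpleTop (K : Freyd (i ⟶ i)) L
  not_annihilates : ∀ (a : C), ∀ F ∈ R a, ¬ IsZero ((act i F).obj L)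

/-- The full subcategory `C_R(a)` of `P_i(a)`: modules with a two-step presentation by direct
summands of finite direct sums of the modules `F L`, `F ∈ R`. -/
def cellSubcategory {i : C} (R : ∀ a : C, Set (i ⟶ a)) (L : Freyd (i ⟶ i)) (a : C) :
    ObjectProperty (Freyd (i ⟶ a)) :=
  presentedBy (fun X => ∃ F ∈ R a, X = (act i F).obj L)

end Cells

end CellTwoRep
end

open CellTwoRep

/-! Fix `F` in the cell. Since `F** ≅ F`, the 1-morphism `F*` is adjoint to `F` on both sides, so
`F` acts exactly on the abelian categories of diagrams. Let `F'` be left adjoint to `F`. The image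
`K` of the counit `F'F P_𝟙 ⟶ P_𝟙` is the smallest submodule whose quotient is killed by `F`
(`exists_isCellKernel`). By minimality `F` kills no nonzero quotient of `K`, while `F K ≅ F P_𝟙 ≅
P_F` is projective with local endomorphism ring. Two distinct simple quotients of `K` would
contradict locality, so `K` has a simple top `L = L_G`. Covering `K` by `P_{F'F}` shows that `G` is
a summand of `F'F`. Covering it by `P_G` shows that `F` is a summand of `FG`. Hence `G` lies in the
cell. Conversely, any `K` with the required properties is this minimal submodule, which gives
uniqueness.

The heart of the second half is that every morphism `P_𝟙 ⟶ H L` kills the kernel of `K ⟶ L`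
(`IsCellTop.comp_eq_zero`). By adjunction the same holds for morphisms `F P_𝟙 ⟶ H L`. As `F L` is
the quotient of the projective `F K ≅ F P_𝟙` by the image of that kernel, `F L` is projective
relative to epimorphisms from summands of sums of modules `H L` with `H` in the cell
(`IsCellTop.exists_lift`).

Let `Q` be the direct sum of the `F L` over representatives of the cell. Relative projectivity makes
presentations by summands of powers of `Q` stay exact under `Hom(Q, -)`, so this functor is an
equivalence onto finitely generated modules over `(End Q)ᵐᵒᵖ`. The same criterion shows that the
diagram categories themselves are module categories. Stability holds because an indecomposable above
the cell either kills `L` or lies in the cell. -/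

noncomputable section

namespace CellTwoRep

/-! ### Recognising module categories through a relative projective generator -/

section Recognition

variable {D : Type v'} [Category.{w'} D] [Preadditive D]

/-- `X` is a direct summand of a finite power of `Q`. -/
def IsSummandOfPower (Q X : D) : Prop :=
  ∃ (n : ℕ) (s : Fin n → (X ⟶ Q)) (t : Fin n → (Q ⟶ X)), ∑ j, s j ≫ t j = 𝟙 X

/-- A presentation `X₁ ⟶ X₀ ⟶ M` by summands of powers of `Q` that stays exact under
`Hom(Q, -)`. -/
structure IsRelativePresentation (Q : D) {X₁ X₀ M : D} (d : X₁ ⟶ X₀) (p : X₀ ⟶ M) : Prop where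
  summand₁ : IsSummandOfPower Q X₁
  summand₀ : IsSummandOfPower Q X₀
  w : d ≫ p = 0
  epi : ∀ {N : D} (g : M ⟶ N), p ≫ g = 0 → g = 0
  desc : ∀ {N : D} (g : X₀ ⟶ N), d ≫ g = 0 → ∃ h : M ⟶ N, p ≫ h = g
  lift : ∀ f : Q ⟶ M, ∃ g : Q ⟶ X₀, g ≫ p = f
  exact : ∀ g : Q ⟶ X₀, g ≫ p = 0 → ∃ h : Q ⟶ X₁, h ≫ d = g

variable {Q : D}

lemma IsSummandOfPower.eq_zero {X N : D} (hX : IsSummandOfPower Q X) (g : X ⟶ N)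
    (h : ∀ x : Q ⟶ X, x ≫ g = 0) : g = 0 := by
  obtain ⟨n, s, t, e⟩ := hX
  rw [← Category.id_comp g, ← e, Preadditive.sum_comp]
  exact Finset.sum_eq_zero fun j _ => by rw [Category.assoc, h, comp_zero]

/-- The elements `t j` generate `Hom(Q, X)`, so a module map is determined by the values `φ (t j)`,
and these assemble to a morphism out of `X`. -/
lemma IsSummandOfPower.exists_hom {X N : D} (hX : IsSummandOfPower Q X)
    (φ : (Q ⟶ X) →ₗ[(End Q)ᵐᵒᵖ] (Q ⟶ N)) : ∃ g : X ⟶ N, ∀ x : Q ⟶ X, x ≫ g = φ x := by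
  obtain ⟨n, s, t, e⟩ := hX
  refine ⟨∑ j, s j ≫ φ (t j), fun x => ?_⟩
  have h : ∀ j, x ≫ s j ≫ φ (t j) = φ (x ≫ s j ≫ t j) := fun j => by
    have := φ.map_smul (MulOpposite.op (x ≫ s j : End Q)) (t j)
    rw [← Category.assoc, ← Category.assoc]
    exact this.symm
  rw [Preadditive.comp_sum]
  simp_rw [h]
  rw [← map_sum, ← Preadditive.comp_sum, e, Category.comp_id]

variable (k : Type uk) [Field k] [Linear k D]

lemma IsRelativePresentation.finite [Module.Finite k (End Q)] {X₁ X₀ M : D} {d : X₁ ⟶ X₀}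
    {p : X₀ ⟶ M} (h : IsRelativePresentation Q d p) : Module.Finite (End Q)ᵐᵒᵖ (Q ⟶ M) := by
  obtain ⟨n, s, t, e⟩ := h.summand₀
  classical
  refine ⟨⟨Finset.univ.image fun j => t j ≫ p, ?_⟩⟩
  rw [eq_top_iff]
  rintro f -
  obtain ⟨g, rfl⟩ := h.lift f
  rw [← Category.comp_id g, ← e, Preadditive.comp_sum, Preadditive.sum_comp]
  refine Submodule.sum_mem _ fun j _ => ?_
  have : (g ≫ s j ≫ t j) ≫ p = (MulOpposite.op (g ≫ s j) : (End Q)ᵐᵒᵖ) • (t j ≫ p) := by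
    simp only [Category.assoc]
    change _ = (g ≫ s j) ≫ t j ≫ p
    simp only [Category.assoc]
  rw [this]
  exact Submodule.smul_mem _ _ (Submodule.subset_span (by simp))

variable (Q) in
/-- The functor `Hom(Q, -)` with values in finitely generated modules. -/
def homFunctor (h : ∀ M : D, Module.Finite (End Q)ᵐᵒᵖ (Q ⟶ M)) :
    D ⥤ FGModuleCat.{w'} (End Q)ᵐᵒᵖ :=
  ObjectProperty.lift _ (preadditiveCoyonedaObj Q) h

section

variable (h : ∀ M : D, Module.Finite (End Q)ᵐᵒᵖ (Q ⟶ M))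

instance : (homFunctor Q h).Additive where
  map_add {X Y f g} := by
    apply FGModuleCat.hom_ext
    ext x
    exact Preadditive.comp_add _ _ _ x f g

instance : (homFunctor Q h).Linear k where
  map_smul {X Y} f c := by
    apply FGModuleCat.hom_ext
    ext x
    refine (Linear.comp_smul _ _ _ x c f).trans ?_
    -- On a module over `(End Q)ᵐᵒᵖ` the scalar `c` acts through `c • 𝟙 Q`.
    refine ((Linear.smul_comp _ _ _ c (𝟙 Q) (x ≫ f)).trans (by rw [Category.id_comp])).symm

end

/-- `Hom(Q, -)` is fully faithful on summands of powers of `Q`; presentations that it keeps exact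
extend this to all objects. Essential surjectivity only needs cokernels of maps between powers. -/
theorem isLinearModuleCategory_of_presentations [Module.Finite k (End Q)]
    (power : ℕ → D)
    (hpow : ∀ n : ℕ, ∃ (s : Fin n → (power n ⟶ Q)) (t : Fin n → (Q ⟶ power n)),
      ∑ j, s j ≫ t j = 𝟙 (power n) ∧ ∀ j l, t j ≫ s l = if j = l then 𝟙 Q else 0)
    (hpres : ∀ M : D, ∃ (X₁ X₀ : D) (d : X₁ ⟶ X₀) (p : X₀ ⟶ M), IsRelativePresentation Q d p)
    (hcok : ∀ {m n : ℕ} (d : power m ⟶ power n),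
      ∃ (M : D) (p : power n ⟶ M), IsRelativePresentation Q d p) :
    IsLinearModuleCategory k D := by
  have hfin : ∀ M : D, Module.Finite (End Q)ᵐᵒᵖ (Q ⟶ M) := fun M => by
    obtain ⟨_, _, _, _, h⟩ := hpres M
    exact h.finite k
  have : Module.Finite k (End Q)ᵐᵒᵖ := Module.Finite.equiv (MulOpposite.opLinearEquiv k)
  have : IsNoetherianRing (End Q)ᵐᵒᵖ := isNoetherian_of_tower k inferInstance
  have : (homFunctor Q hfin).Faithful := by
    refine ⟨fun {M N} f g hfg => ?_⟩
    rw [← sub_eq_zero]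
    obtain ⟨X₁, X₀, d, p, hp⟩ := hpres M
    refine hp.epi _ (hp.summand₀.eq_zero _ fun x => ?_)
    have : (x ≫ p) ≫ f = (x ≫ p) ≫ g :=
      congrArg (fun φ => φ.hom.hom (x ≫ p)) hfg
    rw [Preadditive.comp_sub, Preadditive.comp_sub, sub_eq_zero]
    simpa using this
  have : (homFunctor Q hfin).Full := by
    refine ⟨fun {M N} φ => ?_⟩
    obtain ⟨X₁, X₀, d, p, hp⟩ := hpres M
    let φ' : (Q ⟶ M) →ₗ[(End Q)ᵐᵒᵖ] (Q ⟶ N) := φ.hom.hom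
    let P : (Q ⟶ X₀) →ₗ[(End Q)ᵐᵒᵖ] (Q ⟶ M) := ((preadditiveCoyonedaObj Q).map p).hom
    obtain ⟨g, hg⟩ := hp.summand₀.exists_hom (φ'.comp P)
    have hg' : ∀ x : Q ⟶ X₀, x ≫ g = φ' (x ≫ p) := hg
    obtain ⟨f, hf⟩ := hp.desc g (hp.summand₁.eq_zero _ fun x => by
      rw [← Category.assoc, hg', Category.assoc, hp.w, comp_zero, map_zero])
    refine ⟨f, ?_⟩
    apply FGModuleCat.hom_ext
    ext x
    obtain ⟨y, rfl⟩ := hp.lift x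
    change (y ≫ p) ≫ f = φ' (y ≫ p)
    rw [Category.assoc, hf, hg']
  have : (homFunctor Q hfin).EssSurj := by
    refine ⟨fun V => ?_⟩
    -- Noetherianity gives a finite free presentation of `V`. Its matrix comes from a morphism `d`
    -- of powers of `Q`, and `V` is then `Hom(Q, -)` of the cokernel of `d`.
    obtain ⟨n, π, hπ⟩ := Module.Finite.exists_fin' (End Q)ᵐᵒᵖ V
    obtain ⟨m, ρ, hρ⟩ := Module.Finite.exists_fin' (End Q)ᵐᵒᵖ (LinearMap.ker π)
    have free : ∀ n : ℕ, IsSummandOfPower Q (power n) ∧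
        Nonempty ((Q ⟶ power n) ≃ₗ[(End Q)ᵐᵒᵖ] (Fin n → (End Q)ᵐᵒᵖ)) := fun n => by
      obtain ⟨s, t, e, e'⟩ := hpow n
      refine ⟨⟨n, s, t, e⟩, ⟨LinearEquiv.ofLinearMap
        (LinearMap.pi fun j =>
          { toFun := fun x => MulOpposite.op (x ≫ s j : End Q)
            map_add' := fun x y => by rw [Preadditive.add_comp]; rfl
            map_smul' := fun a x => by
              apply MulOpposite.unop_injective
              exact Category.assoc _ _ _ })
        { toFun := fun a => ∑ j, (a j).unop ≫ t j
          map_add' := fun x y => by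
            rw [← Finset.sum_add_distrib]
            exact Finset.sum_congr rfl fun j _ => Preadditive.add_comp _ _ _ _ _ _
          map_smul' := fun a x => by
            refine Eq.trans ?_ (Preadditive.comp_sum _ _ _).symm
            exact Finset.sum_congr rfl fun j _ => Category.assoc _ _ _ } ?_ ?_⟩⟩
      · refine LinearMap.ext fun a => funext fun l => MulOpposite.unop_injective ?_
        change (∑ j, (a j).unop ≫ t j) ≫ s l = (a l).unop
        rw [Preadditive.sum_comp]
        simp_rw [Category.assoc, e']
        refine (Finset.sum_eq_single l (fun j _ hj => ?_) (by simp)).trans ?_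
        · rw [if_neg hj, comp_zero]
        · rw [if_pos rfl, Category.comp_id]
      · ext x
        change ∑ j, (x ≫ s j) ≫ t j = x
        simp_rw [Category.assoc]
        rw [← Preadditive.comp_sum, e, Category.comp_id]
    obtain ⟨h₀, ⟨e₀⟩⟩ := free n
    obtain ⟨h₁, ⟨e₁⟩⟩ := free m
    obtain ⟨d, hd⟩ := h₁.exists_hom
      (e₀.symm.toLinearMap ∘ₗ (LinearMap.ker π).subtype ∘ₗ ρ ∘ₗ e₁.toLinearMap)
    obtain ⟨M, p, hp⟩ := hcok d
    let P : (Q ⟶ power n) →ₗ[(End Q)ᵐᵒᵖ] (Q ⟶ M) := ((preadditiveCoyonedaObj Q).map p).hom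
    have hP : Function.Surjective P := hp.lift
    have hker : LinearMap.ker P = LinearMap.ker (π ∘ₗ e₀.toLinearMap) := by
      ext x
      rw [LinearMap.mem_ker, LinearMap.mem_ker]
      constructor
      · intro hx
        obtain ⟨y, rfl⟩ := hp.exact x hx
        rw [hd]
        simp
      · intro hx
        obtain ⟨y, hy⟩ := hρ ⟨e₀ x, hx⟩
        have : x = (e₁.symm y) ≫ d := by
          rw [hd]
          apply e₀.injective
          simp [hy]
        rw [this]
        change (e₁.symm y ≫ d) ≫ p = 0
        rw [Category.assoc, hp.w, comp_zero]
    let E : (Q ⟶ M) ≃ₗ[(End Q)ᵐᵒᵖ] V :=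
      (P.quotKerEquivOfSurjective hP).symm ≪≫ₗ Submodule.quotEquivOfEq _ _ hker ≪≫ₗ
        (π ∘ₗ e₀.toLinearMap).quotKerEquivOfSurjective (hπ.comp e₀.surjective)
    have := hfin M
    exact ⟨M, ⟨E.toFGModuleCatIso⟩⟩
  have : (homFunctor Q hfin).IsEquivalence := {}
  refine ⟨(End Q)ᵐᵒᵖ, inferInstance, inferInstance, inferInstance,
    (homFunctor Q hfin).asEquivalence, ?_, ?_⟩
  · change (homFunctor Q hfin).Additive
    infer_instance
  · change (homFunctor Q hfin).Linear k
    infer_instance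

end Recognition

/-! ### Abelian structure and length functions on module categories -/

section Length

variable (D : Type v') [Category.{w'} D] [Preadditive D]

/-- The preadditive category `D` is abelian. -/
class IsAbelianCategory : Prop where
  hasFiniteProducts : HasFiniteProducts D
  hasKernels : HasKernels D
  hasCokernels : HasCokernels D
  isNormalMonoCategory : IsNormalMonoCategory D
  isNormalEpiCategory : IsNormalEpiCategory D

/-- There is a length function on the objects of `D`. -/
class HasLengthFunction : Prop where
  exists_length : ∃ ℓ : D → ℕ,
    (∀ {X Y : D} (f : X ⟶ Y), Mono f → ¬ IsIso f → ℓ X < ℓ Y) ∧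
    (∀ {X Y : D} (f : X ⟶ Y), Epi f → ¬ IsIso f → ℓ Y < ℓ X)

variable {D} {k : Type uk} [Field k] [Linear k D]

lemma isAbelianCategory_of_equivalence {E : Type v} [Category.{w} E] [Abelian E] (e : D ≌ E) :
    IsAbelianCategory D := by
  have h₁ : HasFiniteProducts D :=
    ⟨fun _ => Adjunction.hasLimitsOfShape_of_equivalence e.functor⟩
  let a : Abelian D := abelianOfEquivalence e.functor
  exact ⟨inferInstance, a.has_kernels, a.has_cokernels, a.toIsNormalMonoCategory,
    a.toIsNormalEpiCategory⟩

lemma IsLinearModuleCategory.isAbelianCategory (h : IsLinearModuleCategory k D) :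
    IsAbelianCategory D := by
  obtain ⟨R, _, _, _, e, -⟩ := h
  have : IsNoetherianRing R := isNoetherian_of_tower k inferInstance
  exact isAbelianCategory_of_equivalence e

/-- Module length is finite over a finite dimensional algebra, and it drops strictly along proper
submodules and proper quotients. -/
lemma IsLinearModuleCategory.hasLengthFunction (h : IsLinearModuleCategory k D) :
    HasLengthFunction D := by
  obtain ⟨R, _, _, _, e, -⟩ := h
  have : IsNoetherianRing R := isNoetherian_of_tower k inferInstance
  have : IsArtinianRing R := IsArtinianRing.of_finite k R
  have hfl : ∀ M : FGModuleCat.{w'} R, Module.length R M ≠ ⊤ := fun M => by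
    rw [Module.length_ne_top_iff]
    exact isFiniteLength_iff_isNoetherian_isArtinian.2 ⟨inferInstance, inferInstance⟩
  let G := e.functor ⋙ forget₂ (FGModuleCat.{w'} R) (ModuleCat.{w'} R)
  refine ⟨fun X => (Module.length R (e.functor.obj X)).toNat, fun {X Y} f hf hi => ?_,
    fun {X Y} f hf hi => ?_⟩
  · let φ : e.functor.obj X →ₗ[R] e.functor.obj Y := (G.map f).hom
    have hφ : Function.Injective φ := (ModuleCat.mono_iff_injective (G.map f)).1 inferInstance
    have hs : ¬ Function.Surjective φ := fun hs => hi <| by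
      have : Epi (G.map f) := (ModuleCat.epi_iff_surjective (G.map f)).2 hs
      have : IsIso (G.map f) := isIso_of_mono_of_epi _
      exact isIso_of_reflects_iso f G
    have hlt : Module.length R (LinearMap.range φ) < Module.length R (e.functor.obj Y) :=
      Submodule.length_lt (mt LinearMap.range_eq_top.1 hs)
    rw [← (LinearEquiv.ofInjective φ hφ).length_eq] at hlt
    exact by
      rwa [← ENat.natCast_lt_natCast, ENat.natCast_toNat (hfl _), ENat.natCast_toNat (hfl _)]
  · let φ : e.functor.obj X →ₗ[R] e.functor.obj Y := (G.map f).hom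
    have hφ : Function.Surjective φ := (ModuleCat.epi_iff_surjective (G.map f)).1 inferInstance
    have hs : ¬ Function.Injective φ := fun hs => hi <| by
      have : Mono (G.map f) := (ModuleCat.mono_iff_injective (G.map f)).2 hs
      have : IsIso (G.map f) := isIso_of_mono_of_epi _
      exact isIso_of_reflects_iso f G
    have hlt : Module.length R (e.functor.obj Y) < Module.length R (e.functor.obj X) := by
      rw [← (φ.quotKerEquivOfSurjective hφ).length_eq]
      exact Submodule.length_quotient_lt _ (mt LinearMap.ker_eq_bot.1 hs)
    exact by
      rwa [← ENat.natCast_lt_natCast, ENat.natCast_toNat (hfl _), ENat.natCast_toNat (hfl _)]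

end Length

/-! ### Simple quotients and subquotients by induction on length -/

section Simple

variable {D : Type v'} [Category.{w'} D] [Abelian D] [HasLengthFunction D]

lemma exists_simple_quotient {X : D} (hX : ¬ IsZero X) :
    ∃ (T : D) (q : X ⟶ T), Simple T ∧ Epi q := by
  obtain ⟨ℓ, hm, he⟩ := HasLengthFunction.exists_length (D := D)
  obtain ⟨n, hn⟩ : ∃ n, ℓ X = n := ⟨_, rfl⟩
  induction n using Nat.strong_induction_on generalizing X with
  | _ n ih =>
    subst hn
    by_cases hs : Simple X
    · exact ⟨X, 𝟙 X, hs, inferInstance⟩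
    -- As `X` is nonzero, a monomorphism violating simplicity must be nonzero and not invertible;
    -- its cokernel is a shorter nonzero quotient of `X`.
    · obtain ⟨Y, m, hm₁, h⟩ : ∃ (Y : D) (m : Y ⟶ X), Mono m ∧ ¬ (IsIso m ↔ m ≠ 0) := by
        by_contra! hc
        exact hs ⟨fun {Y} m _ => hc Y m inferInstance⟩
      have hm₀ : m ≠ 0 ∧ ¬ IsIso m := by
        by_cases h₀ : m = 0
        · refine absurd ⟨fun hi => ?_, fun hne => absurd h₀ hne⟩ h
          subst h₀
          exact absurd (IsZero.of_epi_eq_zero (0 : Y ⟶ X) rfl) hX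
        · exact ⟨h₀, fun hi => h ⟨fun _ => h₀, fun _ => hi⟩⟩
      have hne : ¬ Epi m := fun _ => hm₀.2 (isIso_of_mono_of_epi m)
      have hc : ¬ IsZero (cokernel m) := fun hz =>
        hne (Preadditive.epi_of_isZero_cokernel m hz)
      have hπ : ¬ IsIso (cokernel.π m) := fun hi => hm₀.1 <| by
        have := cokernel.condition m
        exact (cancel_mono (cokernel.π m)).1 (by rw [this, zero_comp])
      obtain ⟨T, q, hT, hq⟩ := ih _ (he (cokernel.π m) inferInstance hπ) hc rfl
      exact ⟨T, cokernel.π m ≫ q, hT, epi_comp _ _⟩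

/-- Take a simple quotient of `X`. If `F` kills it, exactness forces `F` not to kill the kernel,
which is shorter. -/
lemma exists_simpleSubquotient_of_exact {E : Type v} [Category.{w} E] [Abelian E] (F : D ⥤ E)
    [PreservesFiniteLimits F] [PreservesFiniteColimits F] {X : D}
    (hX : ¬ IsZero (F.obj X)) : ∃ S, IsSimpleSubquotient S X ∧ ¬ IsZero (F.obj S) := by
  obtain ⟨ℓ, hm, he⟩ := HasLengthFunction.exists_length (D := D)
  obtain ⟨n, hn⟩ : ∃ n, ℓ X = n := ⟨_, rfl⟩
  induction n using Nat.strong_induction_on generalizing X with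
  | _ n ih =>
    subst hn
    have : F.PreservesZeroMorphisms := inferInstance
    have hX' : ¬ IsZero X := fun h => hX (F.map_isZero h)
    obtain ⟨T, q, hT, hq⟩ := exists_simple_quotient hX'
    by_cases hFT : IsZero (F.obj T)
    · have hq₀ : q ≠ 0 := fun h => Simple.not_isZero T (IsZero.of_epi_eq_zero q h)
      have hi : ¬ IsIso (kernel.ι q) := fun hi =>
        hq₀ ((cancel_epi (kernel.ι q)).1 (by rw [kernel.condition, comp_zero]))
      have hk : ¬ IsZero (F.obj (kernel q)) := fun hz => by
        have hmono : Mono (F.map q) := by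
          refine Preadditive.mono_of_isZero_kernel _ (IsZero.of_iso hz (PreservesKernel.iso F q).symm)
        exact hX (IsZero.of_mono (F.map q) hFT)
      obtain ⟨S, ⟨hS, Y, m, p, hm, hp⟩, hS'⟩ := ih _ (hm (kernel.ι q) inferInstance hi) hk rfl
      exact ⟨S, ⟨hS, Y, m ≫ kernel.ι q, p, mono_comp _ _, hp⟩, hS'⟩
    · exact ⟨T, ⟨hT, X, 𝟙 X, q, inferInstance, hq⟩, hFT⟩

end Simple

/-! ### Projectives with local endomorphism ring -/

section Hollow

variable {D : Type v'} [Category.{w'} D] [Abelian D]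

/-- Since `𝟙 - e` kills the nonzero `b`, it is not invertible, so locality makes `e` invertible. -/
lemma isIso_of_comp_eq {P X : D} [IsLocalRing (End P)] (b : P ⟶ X) (hb : b ≠ 0) (e : P ⟶ P)
    (he : e ≫ b = b) : IsIso e := by
  let e' : End P := e
  rcases IsLocalRing.isUnit_or_isUnit_of_add_one (add_sub_cancel e' 1) with hu | hu
  · exact (isUnit_iff_isIso e).1 hu
  · have : IsIso (𝟙 P - e) := (isUnit_iff_isIso (𝟙 P - e)).1 hu
    refine absurd ((cancel_epi (𝟙 P - e)).1 ?_) hb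
    rw [comp_zero, Preadditive.sub_comp, Category.id_comp, he, sub_self]

/-- Proper submodules of `P` are superfluous: were `n ≫ b` epi, lifting `b` through it would give an
automorphism of `P` factoring through `n`, hence killed by `a`. This is the source of every
uniqueness-of-top argument below. -/
lemma not_epi_of_local {P X Y N : D} [Projective P] [IsLocalRing (End P)] (a : P ⟶ X) (ha : a ≠ 0)
    (b : P ⟶ Y) (hb : b ≠ 0) (n : N ⟶ P) (hn : n ≫ a = 0) : ¬ Epi (n ≫ b) := by
  intro _
  have := isIso_of_comp_eq b hb (Projective.factorThru b (n ≫ b) ≫ n)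
    (by rw [Category.assoc, Projective.factorThru_comp])
  exact ha ((cancel_epi (Projective.factorThru b (n ≫ b) ≫ n)).1
    (by rw [Category.assoc, hn, comp_zero, comp_zero]))

/-- A projective object with local endomorphism ring is a direct summand of every projective
object mapping non-trivially to a simple quotient of it. -/
lemma nonempty_retract_of_local {P P' S : D} [Projective P] [Projective P'] [IsLocalRing (End P)]
    [Simple S] (p : P ⟶ S) [Epi p] (p' : P' ⟶ S) [Epi p'] : Nonempty (Retract P P') := by
  have hp : p ≠ 0 := fun h => Simple.not_isZero S (IsZero.of_epi_eq_zero p h)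
  -- Lift each cover of `S` through the other; the composite `i ≫ r` fixes `p`, hence is invertible.
  let i := Projective.factorThru p p'
  let r := Projective.factorThru p' p
  have hir : (i ≫ r) ≫ p = p := by simp [i, r]
  have := isIso_of_comp_eq p hp _ hir
  exact ⟨⟨i, r ≫ inv (i ≫ r), by rw [← Category.assoc]; exact IsIso.hom_inv_id _⟩⟩

lemma hasSimpleTop_of_local {P S : D} [Projective P] [IsLocalRing (End P)] [Simple S]
    (p : P ⟶ S) [Epi p] : HasSimpleTop P S := by
  have hp : p ≠ 0 := fun h => Simple.not_isZero S (IsZero.of_epi_eq_zero p h)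
  refine ⟨inferInstance, p, inferInstance, fun T q hT hq => ?_⟩
  have hq₀ : q ≠ 0 := fun h => Simple.not_isZero T (IsZero.of_epi_eq_zero q h)
  have h : kernel.ι p ≫ q = 0 := by
    by_contra hne
    exact not_epi_of_local p hp q hq₀ _ (kernel.condition p) (epi_of_nonzero_to_simple hne)
  have e : p ≫ Abelian.epiDesc p q h = q := Abelian.comp_epiDesc p q h
  have : IsIso (Abelian.epiDesc p q h) := isIso_of_hom_simple fun h₀ => hq₀ (by
    rw [← e, h₀, comp_zero])
  exact ⟨asIso (Abelian.epiDesc p q h), e⟩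

end Hollow

/-! ### Fitting's lemma for finite dimensional algebras -/

section LocalAlgebra

/-- A finite dimensional algebra without non-trivial idempotents is local. -/
lemma isLocalRing_of_idempotents (k : Type uk) [Field k] {R : Type w} [Ring R] [Algebra k R]
    [Module.Finite k R] [Nontrivial R] (h : ∀ e : R, e * e = e → e = 0 ∨ e = 1) :
    IsLocalRing R := by
  refine .of_isUnit_or_isUnit_one_sub_self fun a => ?_
  -- Write the minimal polynomial of `a` as `X ^ n * q` with `q(0) ≠ 0`. A Bézout relation between
  -- the factors yields the idempotent `x(a) * a ^ n`: if it is `0` then `a` is nilpotent, if it is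
  -- `1` then `a` is invertible.
  open Polynomial in
  obtain ⟨q, hq, hq'⟩ := exists_eq_pow_rootMultiplicity_mul_and_not_dvd (minpoly k a)
    (minpoly.ne_zero (Algebra.IsIntegral.isIntegral a)) 0
  set n := Polynomial.rootMultiplicity 0 (minpoly k a)
  rw [Polynomial.C_0, sub_zero] at hq hq'
  obtain ⟨x, y, hxy⟩ : IsCoprime (Polynomial.X ^ n) q :=
    (Polynomial.irreducible_X.coprime_iff_not_dvd.2 hq').pow_left
  have h0 : a ^ n * Polynomial.aeval a q = 0 := by
    have := minpoly.aeval k a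
    rw [hq] at this
    simpa using this
  have h0' : Polynomial.aeval a q * a ^ n = 0 := by
    have := minpoly.aeval k a
    rw [hq, mul_comm] at this
    simpa using this
  have h1 : Polynomial.aeval a x * a ^ n + Polynomial.aeval a y * Polynomial.aeval a q = 1 := by
    have := congrArg (Polynomial.aeval a) hxy
    simpa using this
  have hc : a ^ n * Polynomial.aeval a x = Polynomial.aeval a x * a ^ n := by
    have := congrArg (Polynomial.aeval a) (mul_comm (Polynomial.X ^ n) x)
    simpa using this
  have hidem : (Polynomial.aeval a x * a ^ n) * (Polynomial.aeval a x * a ^ n) =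
      Polynomial.aeval a x * a ^ n := by
    have : Polynomial.aeval a y * Polynomial.aeval a q * (Polynomial.aeval a x * a ^ n) = 0 := by
      rw [← hc, mul_assoc, ← mul_assoc (Polynomial.aeval a q), h0', zero_mul, mul_zero]
    calc _ = (Polynomial.aeval a x * a ^ n + Polynomial.aeval a y * Polynomial.aeval a q) *
          (Polynomial.aeval a x * a ^ n) := by rw [add_mul, this, add_zero]
      _ = _ := by rw [h1, one_mul]
  rcases h _ hidem with he | he
  · right
    rw [he, zero_add] at h1
    have hn : a ^ n = 0 := by
      have hc' : Polynomial.aeval a q * Polynomial.aeval a y = 1 := by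
        have := congrArg (Polynomial.aeval a) (mul_comm q y)
        rw [← h1]
        simpa using this
      calc a ^ n = a ^ n * (Polynomial.aeval a q * Polynomial.aeval a y) := by rw [hc', mul_one]
        _ = 0 := by rw [← mul_assoc, h0, zero_mul]
    exact IsNilpotent.isUnit_one_sub ⟨n, hn⟩
  · left
    -- For `n = 0` the equation `he` contains no factor `a` to invert; there the inverse comes from
    -- coprimality of `X` and the minimal polynomial.
    rcases Nat.eq_zero_or_pos n with hn | hn
    · rw [hn, pow_zero, one_mul] at hq
      have : minpoly k a = q := hq
      have hcop : IsCoprime Polynomial.X (minpoly k a) :=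
        this ▸ Polynomial.irreducible_X.coprime_iff_not_dvd.2 hq'
      obtain ⟨r, s, hrs⟩ := hcop
      have h2 : Polynomial.aeval a r * a = 1 := by
        have := congrArg (Polynomial.aeval a) hrs
        simpa using this
      have h3 : a * Polynomial.aeval a r = 1 := by
        have := congrArg (Polynomial.aeval a) (mul_comm Polynomial.X r)
        rw [← h2]
        simpa using this
      exact ⟨⟨a, _, h3, h2⟩, rfl⟩
    · obtain ⟨m, hm⟩ := Nat.exists_eq_succ_of_ne_zero hn.ne'
      have h2 : (Polynomial.aeval a x * a ^ m) * a = 1 := by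
        rw [mul_assoc, ← pow_succ, ← Nat.succ_eq_add_one, ← hm, he]
      have h3 : a * (a ^ m * Polynomial.aeval a x) = 1 := by
        rw [← mul_assoc, ← pow_succ', ← Nat.succ_eq_add_one, ← hm, hc, he]
      exact isUnit_iff_exists_and_exists.2 ⟨⟨_, h3⟩, ⟨_, h2⟩⟩

end LocalAlgebra

/-! ### Krull–Schmidt arguments in additive categories -/

section Additive

variable {A : Type v} [Category.{w} A] [Preadditive A] [HasFiniteBiproducts A]

instance (priority := low) : HasBinaryBiproducts A := hasBinaryBiproducts_of_finite_biproducts _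

lemma id_eq_of_iso_biprod {X Y Z : A} (e : X ≅ Y ⊞ Z) :
    𝟙 X = (e.hom ≫ biprod.fst) ≫ (biprod.inl ≫ e.inv) +
      (e.hom ≫ biprod.snd) ≫ (biprod.inr ≫ e.inv) := by
  have := biprod.total (X := Y) (Y := Z)
  calc 𝟙 X = e.hom ≫ (biprod.fst ≫ biprod.inl + biprod.snd ≫ biprod.inr) ≫ e.inv := by
        rw [this]; simp
    _ = _ := by simp only [Preadditive.add_comp, Preadditive.comp_add, Category.assoc]

/-- The complement `Z` splits the idempotent `𝟙 X - r.r ≫ r.i`. -/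
lemma exists_iso_biprod_of_retract [IsIdempotentComplete A] {X Y : A} (r : Retract Y X) :
    ∃ (Z : A) (e : X ≅ Y ⊞ Z), e.hom ≫ biprod.fst = r.r ∧ biprod.inl ≫ e.inv = r.i := by
  obtain ⟨Z, i, p, hip, hpi⟩ := IsIdempotentComplete.idempotents_split X (𝟙 X - r.r ≫ r.i) (by
    simp [Preadditive.sub_comp, Preadditive.comp_sub])
  have h₁ : i ≫ r.r = 0 := by
    have : (p ≫ i) ≫ r.r = 0 := by simp [hpi, Preadditive.sub_comp]
    calc i ≫ r.r = (i ≫ p) ≫ i ≫ r.r := by rw [hip, Category.id_comp]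
      _ = i ≫ (p ≫ i) ≫ r.r := by simp only [Category.assoc]
      _ = 0 := by rw [this, comp_zero]
  have h₂ : r.i ≫ p = 0 := by
    have : r.i ≫ (p ≫ i) = 0 := by simp [hpi, Preadditive.comp_sub]
    calc r.i ≫ p = (r.i ≫ (p ≫ i)) ≫ p := by rw [Category.assoc, Category.assoc, hip, Category.comp_id]
      _ = 0 := by rw [this, zero_comp]
  refine ⟨Z, ⟨biprod.lift r.r p, biprod.desc r.i i, ?_, ?_⟩, ?_, ?_⟩
  · rw [biprod.lift_desc, hpi]
    abel
  · ext <;> simp [h₁, h₂, hip]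
  · simp
  · simp

lemma retract_comp_eq_id_of_indecomposable [IsIdempotentComplete A] {X Y : A} (r : Retract Y X)
    (hX : Indecomposable X) (hY : ¬ IsZero Y) : r.r ≫ r.i = 𝟙 X := by
  obtain ⟨Z, e, h₁, h₂⟩ := exists_iso_biprod_of_retract r
  have hZ : IsZero Z := (hX.2 Y Z e).resolve_left hY
  rw [← h₁, ← h₂, ← cancel_epi e.inv, ← cancel_mono e.hom]
  simp only [Category.assoc, Iso.inv_hom_id_assoc, Iso.inv_hom_id, Category.comp_id]
  ext
  · simp
  · simp
  · exact hZ.eq_of_src _ _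
  · exact hZ.eq_of_src _ _

lemma isLocalRing_end_of_indecomposable [IsIdempotentComplete A] (k : Type uk) [Field k]
    [Linear k A] {X : A} (hX : Indecomposable X) [Module.Finite k (X ⟶ X)] :
    IsLocalRing (End X) := by
  have : Nontrivial (End X) :=
    ⟨⟨0, 1, fun h => hX.1 ((IsZero.iff_id_eq_zero X).2 h.symm)⟩⟩
  have : Module.Finite k (End X) := ‹Module.Finite k (X ⟶ X)›
  refine isLocalRing_of_idempotents k fun e he => ?_
  obtain ⟨Y, i, p, hip, hpi⟩ := IsIdempotentComplete.idempotents_split X e he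
  by_cases hY : IsZero Y
  · left
    rw [← hpi, hY.eq_of_src i 0]
    exact comp_zero
  · right
    rw [← hpi]
    exact retract_comp_eq_id_of_indecomposable ⟨i, p, hip⟩ hX hY

/-- Krull–Schmidt induction. -/
theorem induction_on_indecomposables (k : Type uk) [Field k] [Linear k A]
    (hfin : ∀ X Y : A, Module.Finite k (X ⟶ Y)) {P : A → Prop}
    (zero : ∀ X, IsZero X → P X) (indecomposable : ∀ X, Indecomposable X → P X)
    (sum : ∀ X Y Z, (X ≅ Y ⊞ Z) → P Y → P Z → P X) (X : A) : P X := by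
  obtain ⟨n, hn⟩ : ∃ n, Module.finrank k (X ⟶ X) = n := ⟨_, rfl⟩
  induction n using Nat.strong_induction_on generalizing X with
  | _ n ih =>
    subst hn
    by_cases h0 : IsZero X
    · exact zero X h0
    by_cases hX : Indecomposable X
    · exact indecomposable X hX
    obtain ⟨Y, Z, e, hY, hZ⟩ : ∃ (Y Z : A) (_ : X ≅ Y ⊞ Z), ¬ IsZero Y ∧ ¬ IsZero Z := by
      by_contra! hc
      exact hX ⟨h0, fun Y Z e => or_iff_not_imp_left.2 (hc Y Z e)⟩
    -- Block-diagonal endomorphisms embed `End Y × End Z` into `End X`. Both factors are nonzero, so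
    -- both have smaller dimension and the induction on `dim End X` applies.
    let φ : (Y ⟶ Y) × (Z ⟶ Z) →ₗ[k] (X ⟶ X) :=
      { toFun := fun f => e.hom ≫ biprod.map f.1 f.2 ≫ e.inv
        map_add' := fun f g => by
          rw [← Preadditive.comp_add, ← Preadditive.add_comp]
          congr 2
          ext <;> simp
        map_smul' := fun c f => by
          rw [RingHom.id_apply, ← Linear.comp_smul, ← Linear.smul_comp]
          congr 2
          ext <;> simp }
    have hφ : Function.Injective φ := fun f g hfg => by
      have h : biprod.map f.1 f.2 = biprod.map g.1 g.2 := by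
        have : e.hom ≫ biprod.map f.1 f.2 ≫ e.inv = e.hom ≫ biprod.map g.1 g.2 ≫ e.inv := hfg
        rwa [cancel_epi, cancel_mono] at this
      refine Prod.ext ?_ ?_
      · simpa using congrArg (fun t => biprod.inl ≫ t ≫ biprod.fst) h
      · simpa using congrArg (fun t => biprod.inr ≫ t ≫ biprod.snd) h
    have hle := LinearMap.finrank_le_finrank_of_injective hφ
    rw [Module.finrank_prod] at hle
    have pos : ∀ Y : A, ¬ IsZero Y → 0 < Module.finrank k (Y ⟶ Y) := fun Y hY => by
      have : Nontrivial (Y ⟶ Y) := ⟨⟨𝟙 Y, 0, mt (IsZero.iff_id_eq_zero Y).2 hY⟩⟩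
      exact Module.finrank_pos
    have := pos Y hY
    have := pos Z hZ
    exact sum X Y Z e (ih _ (by omega) Y rfl) (ih _ (by omega) Z rfl)

/-- An additive category with finitely many indecomposable objects has an additive generator. -/
lemma exists_additive_generator (k : Type uk) [Field k] [Linear k A]
    (hfin : ∀ X Y : A, Module.Finite k (X ⟶ Y))
    (hT : ∃ T : Set A, T.Finite ∧ ∀ X : A, Indecomposable X → ∃ Y ∈ T, Nonempty (X ≅ Y)) :
    ∃ G : A, ∀ X : A, IsSummandOfPower G X := by
  obtain ⟨T, hTf, hT⟩ := hT
  have : Finite T := hTf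
  let G : A := ⨁ fun t : T => (t : A)
  refine ⟨G, induction_on_indecomposables k hfin ?_ ?_ ?_⟩
  · intro X hX
    exact ⟨0, Fin.elim0, Fin.elim0, hX.eq_of_src _ _⟩
  · intro X hX
    obtain ⟨Y, hY, ⟨e⟩⟩ := hT X hX
    refine ⟨1, fun _ => e.hom ≫ biproduct.ι (fun t : T => (t : A)) ⟨Y, hY⟩,
      fun _ => biproduct.π (fun t : T => (t : A)) ⟨Y, hY⟩ ≫ e.inv, ?_⟩
    simp
  · rintro X Y Z e ⟨m, s, t, h⟩ ⟨n, s', t', h'⟩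
    refine ⟨m + n, fun j => e.hom ≫ Fin.addCases (fun j => biprod.fst ≫ s j)
      (fun j => biprod.snd ≫ s' j) j, fun j => Fin.addCases (fun j => t j ≫ biprod.inl)
      (fun j => t' j ≫ biprod.inr) j ≫ e.inv, ?_⟩
    rw [Fin.sum_univ_add]
    simp only [Fin.addCases_left, Fin.addCases_right, Category.assoc]
    have h₁ : ∑ j, e.hom ≫ biprod.fst ≫ s j ≫ t j ≫ biprod.inl ≫ e.inv =
        e.hom ≫ biprod.fst ≫ (∑ j, s j ≫ t j) ≫ biprod.inl ≫ e.inv := by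
      simp [Preadditive.comp_sum, Preadditive.sum_comp]
    have h₂ : ∑ j, e.hom ≫ biprod.snd ≫ s' j ≫ t' j ≫ biprod.inr ≫ e.inv =
        e.hom ≫ biprod.snd ≫ (∑ j, s' j ≫ t' j) ≫ biprod.inr ≫ e.inv := by
      simp [Preadditive.comp_sum, Preadditive.sum_comp]
    rw [h₁, h₂, h, h', Category.id_comp, Category.id_comp, ← Preadditive.comp_add]
    have := biprod.total (X := Y) (Y := Z)
    calc _ = e.hom ≫ (biprod.fst ≫ biprod.inl + biprod.snd ≫ biprod.inr) ≫ e.inv := by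
          simp only [Preadditive.add_comp, Category.assoc]
      _ = _ := by rw [this]; simp

end Additive

/-! ### Projectives and presentations in the category of diagrams -/

namespace Freyd

variable {A : Type v} [Category.{w} A] [Preadditive A]

variable (A) in
/-- The functor sending a diagram to itself, viewed as an object of `Freyd A`. -/
abbrev quo : Arrow A ⥤ Freyd A := CategoryTheory.Quotient.functor (freydRel A)

lemma quo_map_eq_iff {M N : Arrow A} (f g : M ⟶ N) :
    (quo A).map f = (quo A).map g ↔ ∃ ξ : M.right ⟶ N.left, ξ ≫ N.hom = f.right - g.right :=
  CategoryTheory.Quotient.functor_map_eq_iff _ _ _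

lemma quo_map_eq_of_right {M N : Arrow A} {f g : M ⟶ N} (h : f.right = g.right) :
    (quo A).map f = (quo A).map g :=
  (quo_map_eq_iff _ _).2 ⟨0, by simp [h]⟩

lemma quo_map_eq_zero_iff {M N : Arrow A} (f : M ⟶ N) :
    (quo A).map f = 0 ↔ ∃ ξ : M.right ⟶ N.left, ξ ≫ N.hom = f.right := by
  rw [← Functor.map_zero, quo_map_eq_iff]
  simp

variable [HasZeroObject A]

/-- The functor sending `β : X ⟶ Y` to the square from `0 ⟶ X` to `0 ⟶ Y` given by `β`. -/
def projFunctor : A ⥤ Freyd A where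
  obj X := (quo A).obj (Arrow.mk (0 : (0 : A) ⟶ X))
  map {X Y} β := (quo A).map
    (Arrow.homMk (u := 0) (v := β) : Arrow.mk (0 : (0 : A) ⟶ X) ⟶ Arrow.mk (0 : (0 : A) ⟶ Y))
  map_id X := by
    refine Eq.trans ?_ ((quo A).map_id _)
    exact quo_map_eq_of_right rfl
  map_comp f g := by
    refine Eq.trans ?_ ((quo A).map_comp _ _)
    exact quo_map_eq_of_right rfl

/-- The morphism from `0 ⟶ X` to the diagram `M` given by a morphism from `X` to the target
of `M`. -/
def projHom {X : A} (M : Arrow A) (β : X ⟶ M.right) : projFunctor.obj X ⟶ (quo A).obj M :=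
  (quo A).map (Arrow.homMk (u := 0) (v := β) (by simp) : Arrow.mk (0 : (0 : A) ⟶ X) ⟶ M)

lemma projHom_surjective {X : A} (M : Arrow A) (f : projFunctor.obj X ⟶ (quo A).obj M) :
    ∃ β, projHom M β = f := by
  obtain ⟨g, rfl⟩ := (quo A).map_surjective (X := Arrow.mk (0 : (0 : A) ⟶ X)) f
  exact ⟨g.right, quo_map_eq_of_right rfl⟩

lemma projHom_eq_zero_iff {X : A} {M : Arrow A} (β : X ⟶ M.right) :
    projHom M β = 0 ↔ ∃ ξ : X ⟶ M.left, ξ ≫ M.hom = β :=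
  quo_map_eq_zero_iff (M := Arrow.mk (0 : (0 : A) ⟶ X)) _

lemma projFunctor_map_comp_projHom {X Y : A} {M : Arrow A} (γ : X ⟶ Y) (β : Y ⟶ M.right) :
    projFunctor.map γ ≫ projHom M β = projHom M (γ ≫ β) :=
  ((quo A).map_comp _ _).symm.trans (quo_map_eq_of_right rfl)

lemma projHom_comp_map {X : A} {M N : Arrow A} (β : X ⟶ M.right) (f : M ⟶ N) :
    projHom M β ≫ (quo A).map f = projHom N (β ≫ f.right) :=
  ((quo A).map_comp _ _).symm.trans (quo_map_eq_of_right rfl)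

lemma projHom_sub {X : A} {M : Arrow A} (β γ : X ⟶ M.right) :
    projHom M (β - γ) = projHom M β - projHom M γ :=
  by
  refine Eq.trans ?_ ((quo A).map_sub
    (f := (Arrow.homMk (u := 0) (v := β) (by simp) : Arrow.mk (0 : (0 : A) ⟶ X) ⟶ M))
    (g := Arrow.homMk (u := 0) (v := γ) (by simp)))
  exact quo_map_eq_of_right rfl

instance : (projFunctor (A := A)).Full where
  map_surjective {X Y} f := by
    obtain ⟨β, rfl⟩ := projHom_surjective (Arrow.mk (0 : (0 : A) ⟶ Y)) f
    exact ⟨β, rfl⟩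

instance : (projFunctor (A := A)).Additive where
  map_add {X Y f g} := by
    refine Eq.trans ?_ ((quo A).map_add
      (f := (Arrow.homMk (u := 0) (v := f) :
        Arrow.mk (0 : (0 : A) ⟶ X) ⟶ Arrow.mk (0 : (0 : A) ⟶ Y)))
      (g := Arrow.homMk (u := 0) (v := g)))
    exact quo_map_eq_of_right rfl

instance : (projFunctor (A := A)).Faithful where
  map_injective {X Y} f g h := by
    obtain ⟨ξ, hξ⟩ := (quo_map_eq_iff (M := Arrow.mk (0 : (0 : A) ⟶ X))
      (N := Arrow.mk (0 : (0 : A) ⟶ Y)) _ _).1 h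
    rw [← sub_eq_zero]
    exact hξ.symm.trans comp_zero

section Linear

variable (k : Type uk) [Field k] [Linear k A]

instance : (projFunctor (A := A)).Linear k where
  map_smul {X Y} f c := by
    refine Eq.trans ?_ (Functor.map_smul (quo A) (r := c)
      (f := (Arrow.homMk (u := 0) (v := f) :
        Arrow.mk (0 : (0 : A) ⟶ X) ⟶ Arrow.mk (0 : (0 : A) ⟶ Y))))
    exact quo_map_eq_of_right rfl

instance (X Y : A) [Module.Finite k (X ⟶ Y)] :
    Module.Finite k (projFunctor.obj X ⟶ projFunctor.obj Y) :=
  Module.Finite.of_surjective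
    (projFunctor.mapLinearMap k : (X ⟶ Y) →ₗ[k] (projFunctor.obj X ⟶ projFunctor.obj Y))
    projFunctor.map_surjective

end Linear

/-- The projection from the target of a diagram `M`. -/
def projCover (M : Arrow A) : projFunctor.obj M.right ⟶ (quo A).obj M :=
  projHom M (𝟙 _)

lemma map_comp_projCover {X : A} {M : Arrow A} (γ : X ⟶ M.right) :
    projFunctor.map γ ≫ projCover M = projHom M γ := by
  rw [projCover, projFunctor_map_comp_projHom, Category.comp_id]

lemma projCover_comp_eq_zero (M : Arrow A) {N : Freyd A} (g : (quo A).obj M ⟶ N)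
    (h : projCover M ≫ g = 0) : g = 0 := by
  obtain ⟨N⟩ := N
  obtain ⟨f, rfl⟩ := (quo A).map_surjective (Y := N) g
  refine (quo_map_eq_zero_iff _).2 ?_
  obtain ⟨ξ, hξ⟩ := (projHom_eq_zero_iff (M := N) _).1 ((projHom_comp_map _ _).symm.trans h)
  exact ⟨ξ, hξ.trans (Category.id_comp _)⟩

instance (M : Arrow A) : Epi (projCover M) :=
  Preadditive.epi_of_cancel_zero _ fun g h => projCover_comp_eq_zero M g h

/-- A diagram is the cokernel of its own arrow, read as a map of projectives. Exactness is the
definition of a null square: a map from `P_X` vanishes exactly when it factors through the arrow. -/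
lemma isRelativePresentation {G : A} {M : Arrow A} (h₁ : IsSummandOfPower G M.left)
    (h₀ : IsSummandOfPower G M.right) :
    IsRelativePresentation (projFunctor.obj G) (projFunctor.map M.hom) (projCover M) := by
  have hs : ∀ X : A, IsSummandOfPower G X →
      IsSummandOfPower (projFunctor.obj G) (projFunctor.obj X) := by
    rintro X ⟨n, s, t, e⟩
    refine ⟨n, fun j => projFunctor.map (s j), fun j => projFunctor.map (t j), ?_⟩
    simp_rw [← Functor.map_comp]
    rw [← Functor.map_sum, e, projFunctor.map_id]
  refine ⟨hs _ h₁, hs _ h₀, ?_, fun g hg => projCover_comp_eq_zero M g hg, ?_, ?_, ?_⟩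
  · rw [map_comp_projCover]
    exact (projHom_eq_zero_iff _).2 ⟨𝟙 _, Category.id_comp _⟩
  · rintro ⟨N⟩ g hg
    obtain ⟨β, rfl⟩ := projHom_surjective N g
    obtain ⟨ξ, hξ⟩ := (projHom_eq_zero_iff (M := N) _).1
      ((projFunctor_map_comp_projHom _ _).symm.trans hg)
    refine ⟨(quo A).map (Arrow.homMk (u := ξ) (v := β) hξ : M ⟶ N), ?_⟩
    exact (projHom_comp_map _ _).trans (quo_map_eq_of_right (Category.id_comp _))
  · intro f
    obtain ⟨β, rfl⟩ := projHom_surjective M f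
    exact ⟨projFunctor.map β, map_comp_projCover β⟩
  · intro g hg
    obtain ⟨β, rfl⟩ := projFunctor.map_surjective g
    obtain ⟨ξ, hξ⟩ := (projHom_eq_zero_iff (M := M) _).1 ((map_comp_projCover _).symm.trans hg)
    refine ⟨projFunctor.map ξ, ?_⟩
    rw [← Functor.map_comp, hξ]

instance [HasFiniteBiproducts A] (X : A) : Projective (projFunctor.obj X) where
  factors {N' M'} f e he := by
    obtain ⟨M⟩ := M'
    obtain ⟨N⟩ := N'
    obtain ⟨γ, rfl⟩ := projHom_surjective M f
    obtain ⟨ε', rfl⟩ := (quo A).map_surjective (X := N) (Y := M) e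
    -- This diagram models the cokernel of `e`. As `e` is epi, the class of `c` is zero, and the
    -- witness `ξ` splits `𝟙 M.right` into a part through `M.hom`, which is null, and a part through
    -- `ε'.right`, which gives the lift of `γ`.
    let c : M ⟶ Arrow.mk (biprod.desc M.hom ε'.right) :=
      Arrow.homMk (u := biprod.inl) (v := 𝟙 _) (by simp)
    have hc : (quo A).map ε' ≫ (quo A).map c = 0 := by
      rw [← Functor.map_comp]
      exact (quo_map_eq_zero_iff _).2 ⟨biprod.inr, by simp [c]⟩
    have he' : Epi ((quo A).map ε') := he
    obtain ⟨ξ, hξ⟩ := (quo_map_eq_zero_iff c).1 ((cancel_epi ((quo A).map ε')).1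
      (hc.trans comp_zero.symm))
    have hξ' : ξ ≫ biprod.fst ≫ M.hom + ξ ≫ biprod.snd ≫ ε'.right = 𝟙 M.right := by
      refine Eq.trans ?_ hξ
      simp [biprod.desc_eq]
    refine ⟨projHom N (γ ≫ ξ ≫ biprod.snd), ?_⟩
    rw [← sub_eq_zero]
    refine (congrArg (· - projHom M γ) (projHom_comp_map _ _)).trans ?_
    refine (projHom_sub _ _).symm.trans ((projHom_eq_zero_iff _).2 ⟨-(γ ≫ ξ ≫ biprod.fst), ?_⟩)
    have h := congrArg (γ ≫ ·) hξ'
    simp only [Preadditive.comp_add, Category.comp_id] at h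
    rw [Preadditive.neg_comp, neg_eq_iff_eq_neg, neg_sub, eq_sub_iff_add_eq]
    refine Eq.trans ?_ h
    simp

/-- Precomposition with the epimorphism `projCover M` embeds this space into morphisms out of a
projective, and those are a quotient of a morphism space of `A`. -/
instance finite_hom (k : Type uk) [Field k] [Linear k A] [∀ X Y : A, Module.Finite k (X ⟶ Y)]
    (M N : Freyd A) : Module.Finite k (M ⟶ N) := by
  obtain ⟨M⟩ := M
  obtain ⟨N⟩ := N
  let φ : (M.right ⟶ N.right) →ₗ[k] (projFunctor.obj M.right ⟶ (quo A).obj N) :=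
    { toFun := projHom N
      map_add' := fun f g => by
        rw [← sub_neg_eq_add, projHom_sub, ← zero_sub, projHom_sub,
          (projHom_eq_zero_iff (M := N) (0 : M.right ⟶ N.right)).2 ⟨0, zero_comp⟩, zero_sub,
          sub_neg_eq_add]
      map_smul' := fun c f => by
        refine Eq.trans ?_ (Functor.map_smul (quo A) (r := c)
          (f := (Arrow.homMk (u := 0) (v := f) (by simp) :
            Arrow.mk (0 : (0 : A) ⟶ M.right) ⟶ N)))
        exact quo_map_eq_of_right rfl }
  have : Module.Finite k (projFunctor.obj M.right ⟶ (quo A).obj N) :=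
    Module.Finite.of_surjective φ (projHom_surjective N)
  exact Module.Finite.of_injective (Linear.leftComp k ((quo A).obj N) (projCover M))
    fun f g h => (cancel_epi (projCover M)).1 h

/-- The recognition criterion applies to `P_G` for an additive generator `G`: since `projFunctor` is
full, a map between powers of `P_G` is an arrow of `A`, and that arrow as a diagram is its cokernel.
-/
theorem isLinearModuleCategory [HasFiniteBiproducts A] (k : Type uk) [Field k] [Linear k A]
    (hfin : ∀ X Y : A, Module.Finite k (X ⟶ Y))
    (hT : ∃ T : Set A, T.Finite ∧ ∀ X : A, Indecomposable X → ∃ Y ∈ T, Nonempty (X ≅ Y)) :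
    IsLinearModuleCategory k (Freyd A) := by
  obtain ⟨G, hG⟩ := exists_additive_generator k hfin hT
  have : Module.Finite k (End (projFunctor.obj G)) :=
    inferInstanceAs (Module.Finite k (projFunctor.obj G ⟶ projFunctor.obj G))
  refine isLinearModuleCategory_of_presentations (Q := projFunctor.obj G) k
    (fun n => projFunctor.obj (⨁ fun _ : Fin n => G)) (fun n => ?_) (fun M => ?_)
    fun {m n} d => ?_
  · refine ⟨fun j => projFunctor.map (biproduct.π (fun _ => G) j),
      fun j => projFunctor.map (biproduct.ι (fun _ => G) j), ?_, fun j l => ?_⟩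
    · simp_rw [← Functor.map_comp]
      rw [← Functor.map_sum, biproduct.total, projFunctor.map_id]
    · rw [← Functor.map_comp, biproduct.ι_π]
      split_ifs with h
      · exact projFunctor.map_id _
      · exact projFunctor.map_zero _ _
  · obtain ⟨M⟩ := M
    exact ⟨_, _, _, _, isRelativePresentation (hG M.left) (hG M.right)⟩
  · obtain ⟨α, rfl⟩ := projFunctor.map_surjective d
    exact ⟨_, _, isRelativePresentation (M := Arrow.mk α) (hG _) (hG _)⟩

lemma isLocalRing_end_proj [HasFiniteBiproducts A] [IsIdempotentComplete A] (k : Type uk) [Field k]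
    [Linear k A] {X : A} (hX : Indecomposable X) [Module.Finite k (X ⟶ X)] :
    IsLocalRing (End (projFunctor.obj X)) := by
  have := isLocalRing_end_of_indecomposable k hX
  have : Nontrivial (End (projFunctor.obj X)) := ⟨⟨0, 1, fun h => hX.1 <| by
    rw [IsZero.iff_id_eq_zero]
    apply projFunctor.map_injective
    rw [projFunctor.map_id, projFunctor.map_zero]
    exact h.symm⟩⟩
  refine .of_isUnit_or_isUnit_one_sub_self fun a => ?_
  obtain ⟨b, hb⟩ := projFunctor.map_surjective a
  let b' : End X := b
  rcases IsLocalRing.isUnit_or_isUnit_of_add_one (add_sub_cancel b' 1) with hu | hu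
  · left
    have : IsIso b := (isUnit_iff_isIso b).1 hu
    rw [← hb]
    exact (isUnit_iff_isIso (projFunctor.map b)).2 inferInstance
  · right
    have : IsIso (𝟙 X - b) := (isUnit_iff_isIso (𝟙 X - b)).1 hu
    have h : (1 - a : End (projFunctor.obj X)) = projFunctor.map (𝟙 X - b) := by
      rw [Functor.map_sub, projFunctor.map_id, hb]
      rfl
    rw [h]
    exact (isUnit_iff_isIso (projFunctor.map (𝟙 X - b))).2 inferInstance

lemma exists_indecomposable_of_nonzero [HasFiniteBiproducts A] (k : Type uk) [Field k] [Linear k A]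
    (hfin : ∀ X Y : A, Module.Finite k (X ⟶ Y)) {M : Freyd A} (hM : ¬ IsZero M) :
    ∃ (X : A) (p : projFunctor.obj X ⟶ M), Indecomposable X ∧ p ≠ 0 := by
  by_contra! hc
  have h : ∀ X : A, ∀ p : projFunctor.obj X ⟶ M, p = 0 := by
    refine induction_on_indecomposables k hfin (fun X hX p => ?_) (fun X hX p => hc X p hX) ?_
    · exact (projFunctor.map_isZero hX).eq_of_src _ _
    · intro X Y Z e hY hZ p
      rw [← Category.id_comp p, ← projFunctor.map_id, id_eq_of_iso_biprod e, Functor.map_add, projFunctor.map_comp (e.hom ≫ biprod.fst),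
        projFunctor.map_comp (e.hom ≫ biprod.snd), Preadditive.add_comp, Category.assoc, Category.assoc,
        hY (projFunctor.map (biprod.inl ≫ e.inv) ≫ p),
        hZ (projFunctor.map (biprod.inr ≫ e.inv) ≫ p), comp_zero, comp_zero, add_zero]
  obtain ⟨M⟩ := M
  exact hM (IsZero.of_epi_eq_zero _ (h _ (projCover M)))

end Freyd

/-! ### Field-independent consequences of fiatness -/

section FiatConsequences

variable (C : Type u) [Bicategory.{w, v} C] [∀ a b : C, Preadditive (a ⟶ b)]
  [IsAdditiveTwoCategory C]

/-- The consequences of fiatness which do not refer to the ground field. -/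
class HasFiatProperties : Prop where
  isAbelianCategory (a b : C) : IsAbelianCategory (Freyd (a ⟶ b))
  hasLengthFunction (a b : C) : HasLengthFunction (Freyd (a ⟶ b))
  isLocalRing_end {a b : C} (F : a ⟶ b) (hF : Indecomposable F) :
    IsLocalRing (End (Freyd.projFunctor.obj F))
  exists_indecomposable {a b : C} {M : Freyd (a ⟶ b)} (hM : ¬ IsZero M) :
    ∃ (F : a ⟶ b) (p : Freyd.projFunctor.obj F ⟶ M), Indecomposable F ∧ p ≠ 0
  induction {a b : C} {P : (a ⟶ b) → Prop} (zero : ∀ X, IsZero X → P X)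
    (indecomposable : ∀ X, Indecomposable X → P X)
    (sum : ∀ X Y Z : a ⟶ b, (X ≅ Y ⊞ Z) → P Y → P Z → P X) (X : a ⟶ b) : P X
  exists_biadjoint {a b : C} (F : a ⟶ b) :
    ∃ F' : b ⟶ a, Nonempty (F ⊣ F') ∧ Nonempty (F' ⊣ F)

variable {C} in
/-- Transport of an adjunction along an isomorphism of right adjoints. -/
def adjunctionOfIsoRight {a b : C} {F : a ⟶ b} {G G' : b ⟶ a} (adj : F ⊣ G) (e : G ≅ G') :
    F ⊣ G' where
  unit := adj.unit ≫ F ◁ e.hom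
  counit := e.inv ▷ F ≫ adj.counit
  left_triangle := by
    calc
      _ = adj.unit ▷ F ⊗≫ F ◁ ((e.hom ≫ e.inv) ▷ F) ⊗≫ F ◁ adj.counit := by bicategory
      _ = leftZigzag adj.unit adj.counit := by rw [e.hom_inv_id]; bicategory
      _ = _ := adj.left_triangle
  right_triangle := by
    calc
      _ = 𝟙 _ ⊗≫ G' ◁ adj.unit ⊗≫ ((G' ≫ F) ◁ e.hom ≫ (e.inv ▷ F) ▷ G') ⊗≫
          adj.counit ▷ G' := by bicategory
      _ = 𝟙 _ ⊗≫ (G' ◁ adj.unit ≫ e.inv ▷ (F ≫ G)) ⊗≫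
          ((G ≫ F) ◁ e.hom ≫ adj.counit ▷ G') := by
        rw [whisker_exchange]; bicategory
      _ = 𝟙 _ ⊗≫ e.inv ▷ 𝟙 a ⊗≫ (rightZigzag adj.unit adj.counit) ⊗≫ 𝟙 b ◁ e.hom := by
        rw [whisker_exchange, whisker_exchange]; bicategory
      _ = (ρ_ G').hom ≫ (e.inv ≫ e.hom) ≫ (λ_ G').inv := by
        rw [adj.right_triangle]; bicategory
      _ = _ := by rw [e.inv_hom_id, Category.id_comp]

variable {C} in
lemma IsFiat.hasFiatProperties {k : Type uk} [Field k] [∀ a b : C, Linear k (a ⟶ b)]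
    (h : IsFiat C k) : HasFiatProperties C where
  isAbelianCategory a b := (Freyd.isLinearModuleCategory k h.finite_hom
    (h.finite_indecomposable a b)).isAbelianCategory
  hasLengthFunction a b := (Freyd.isLinearModuleCategory k h.finite_hom
    (h.finite_indecomposable a b)).hasLengthFunction
  isLocalRing_end {a b} F hF := by
    have := h.finite_hom F F
    have := IsAdditiveTwoCategory.isIdempotentComplete a b
    exact Freyd.isLocalRing_end_proj k hF
  exists_indecomposable hM := Freyd.exists_indecomposable_of_nonzero k h.finite_hom hM
  induction zero ind sum X := induction_on_indecomposables k h.finite_hom zero ind sum X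
  exists_biadjoint {a b} F := by
    obtain ⟨I, hI⟩ := h.involution
    obtain ⟨adj⟩ := hI F
    obtain ⟨adj'⟩ := hI (I.star.obj (op F))
    obtain ⟨e⟩ := I.starStar F
    -- `F*` is left adjoint to `F**`, which is isomorphic to `F`.
    exact ⟨I.star.obj (op F), ⟨adj⟩, ⟨adjunctionOfIsoRight adj' e⟩⟩

variable [HasFiatProperties C]

instance (a b : C) : Abelian (Freyd (a ⟶ b)) :=
  have h := HasFiatProperties.isAbelianCategory a b
  { toIsNormalMonoCategory := h.isNormalMonoCategory
    toIsNormalEpiCategory := h.isNormalEpiCategory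
    has_finite_products := h.hasFiniteProducts
    has_kernels := h.hasKernels
    has_cokernels := h.hasCokernels }

instance (a b : C) : HasLengthFunction (Freyd (a ⟶ b)) :=
  HasFiatProperties.hasLengthFunction a b

end FiatConsequences

/-! ### The action on diagrams: projectives, additivity and exactness -/

section Act

variable {C : Type u} [Bicategory.{w, v} C] [∀ a b : C, Preadditive (a ⟶ b)]
  [IsAdditiveTwoCategory C]

/-- The isomorphism `F P_X ≅ P_{F X}`. -/
def mapProjIso {A B : Type v} [Category.{w} A] [Preadditive A] [Category.{w} B] [Preadditive B]
    [HasZeroObject A] [HasZeroObject B] (Φ : A ⥤ B) [Φ.Additive] (X : A) :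
    (Freyd.map Φ).obj (Freyd.projFunctor.obj X) ≅ Freyd.projFunctor.obj (Φ.obj X) :=
  (Freyd.quo B).mapIso (Arrow.isoMk
    (f := Φ.mapArrow.obj (Arrow.mk (0 : (0 : A) ⟶ X)))
    (g := Arrow.mk (0 : (0 : B) ⟶ Φ.obj X)) Φ.mapZeroObject (Iso.refl _)
    ((Φ.map_isZero (isZero_zero A)).eq_of_src _ _))

/-- The isomorphism `F P_X ≅ P_{F ∘ X}`. -/
def actProjIso {i a b : C} (X : i ⟶ a) (F : a ⟶ b) :
    (act i F).obj (Freyd.projFunctor.obj X) ≅ Freyd.projFunctor.obj (X ≫ F) :=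
  mapProjIso (postcomp i F) X

/-- The isomorphism `F P_{𝟙 i} ≅ P_F`. -/
def actProjIdIso {i a : C} (F : i ⟶ a) :
    (act i F).obj (Freyd.projFunctor.obj (𝟙 i)) ≅ Freyd.projFunctor.obj F :=
  actProjIso (𝟙 i) F ≪≫ Freyd.projFunctor.mapIso (λ_ F)

/-- The functor `F ↦ F X`. -/
def evalFunctor {i a : C} (X : Freyd (i ⟶ a)) (b : C) : (a ⟶ b) ⥤ Freyd (i ⟶ b) where
  obj F := (act i F).obj X
  map η := (actNat i η).app X
  map_id F := by
    have e : postcompNat i (𝟙 F) = 𝟙 _ := by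
      ext Y
      exact whiskerLeft_id Y F
    have := (congrArg Freyd.mapNat e).trans (Freyd.mapNat_id _)
    exact congrArg (fun t => t.app X) this
  map_comp η θ := by
    have e : postcompNat i (η ≫ θ) = postcompNat i η ≫ postcompNat i θ := by
      ext Y
      exact whiskerLeft_comp Y η θ
    have := (congrArg Freyd.mapNat e).trans (Freyd.mapNat_comp _ _)
    exact congrArg (fun t => t.app X) this

instance {i a : C} (X : Freyd (i ⟶ a)) (b : C) : (evalFunctor X b).Additive where
  map_add {F G η θ} := by
    obtain ⟨X⟩ := X
    refine Eq.trans ?_ ((Freyd.quo (i ⟶ b)).map_add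
      (f := ((Functor.mapArrowFunctor _ _).map (postcompNat i η)).app X)
      (g := ((Functor.mapArrowFunctor _ _).map (postcompNat i θ)).app X))
    exact Freyd.quo_map_eq_of_right (IsAdditiveTwoCategory.whiskerLeft_add _ _ _)

instance {i a b : C} (F : a ⟶ b) : (act i F).Additive where
  map_add {X Y f g} := by
    obtain ⟨X⟩ := X
    obtain ⟨Y⟩ := Y
    obtain ⟨f, rfl⟩ := (Freyd.quo (i ⟶ a)).map_surjective (X := X) (Y := Y) f
    obtain ⟨g, rfl⟩ := (Freyd.quo (i ⟶ a)).map_surjective (X := X) (Y := Y) g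
    have h : (Freyd.quo (i ⟶ a)).map f + (Freyd.quo (i ⟶ a)).map g =
      (Freyd.quo (i ⟶ a)).map (f + g) := ((Freyd.quo (i ⟶ a)).map_add).symm
    refine (congrArg (act i F).map h).trans ?_
    refine Eq.trans ?_ ((Freyd.quo (i ⟶ b)).map_add (f := (postcomp i F).mapArrow.map f)
      (g := (postcomp i F).mapArrow.map g))
    exact Freyd.quo_map_eq_of_right (IsAdditiveTwoCategory.add_whiskerRight _ _ _)

variable [Bicategory.Strict C]

/-- The isomorphism `(G ∘ F) X ≅ G (F X)`. -/
def actCompIso {i a b c : C} (F : a ⟶ b) (G : b ⟶ c) (X : Freyd (i ⟶ a)) :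
    (act i (F ≫ G)).obj X ≅ (act i G).obj ((act i F).obj X) :=
  eqToIso (congrArg (fun Φ => Φ.toFunctor.obj X) ((principal i).map_comp F G))

/-- The adjunction of the actions of adjoint 1-morphisms. -/
def actAdjunction (i : C) {a b : C} {F : a ⟶ b} {G : b ⟶ a} (adj : F ⊣ G) :
    CategoryTheory.Adjunction (act i F) (act i G) :=
  CategoryTheory.Adjunction.ofCat ((principal i).mapAdjunction adj)

variable [HasFiatProperties C]

instance {i a b : C} (F : a ⟶ b) : PreservesFiniteLimits (act i F) := by
  obtain ⟨F', -, ⟨adj⟩⟩ := HasFiatProperties.exists_biadjoint F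
  have := (actAdjunction i adj).rightAdjoint_preservesLimits
  infer_instance

instance {i a b : C} (F : a ⟶ b) : PreservesFiniteColimits (act i F) := by
  obtain ⟨F', ⟨adj⟩, -⟩ := HasFiatProperties.exists_biadjoint F
  have := (actAdjunction i adj).leftAdjoint_preservesColimits
  infer_instance

end Act

/-! ### Exact functors, kernels and cokernels -/

section ExactFunctor

variable {D : Type v'} [Category.{w'} D] [Abelian D] {E : Type v} [Category.{w} E] [Abelian E]
  (Φ : D ⥤ E) [PreservesFiniteLimits Φ] [PreservesFiniteColimits Φ]

lemma isIso_map_iff_isZero_cokernel {X Y : D} (m : X ⟶ Y) [Mono m] :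
    IsIso (Φ.map m) ↔ IsZero (Φ.obj (cokernel m)) := by
  have e : Φ.obj (cokernel m) ≅ cokernel (Φ.map m) := PreservesCokernel.iso Φ m
  constructor
  · intro h
    exact IsZero.of_iso (isZero_cokernel_of_epi (Φ.map m)) e
  · intro h
    have : Epi (Φ.map m) := Preadditive.epi_of_isZero_cokernel _ (IsZero.of_iso h e.symm)
    exact isIso_of_mono_of_epi _

omit [PreservesFiniteColimits Φ] in
lemma isIso_map_kernel_ι {X Y : D} (q : X ⟶ Y) (h : IsZero (Φ.obj Y)) :
    IsIso (Φ.map (kernel.ι q)) := by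
  have key : ∀ f : Φ.obj X ⟶ Φ.obj Y, f = 0 → IsIso (kernel.ι f) := by
    rintro _ rfl
    infer_instance
  have := key (Φ.map q) (h.eq_of_tgt _ _)
  rw [← kernelComparison_comp_ι q Φ]
  infer_instance

lemma exists_map_epi_desc {X Y : D} {Z : E} (p : X ⟶ Y) [Epi p] (g : Φ.obj X ⟶ Z)
    (h : Φ.map (kernel.ι p) ≫ g = 0) : ∃ g' : Φ.obj Y ⟶ Z, Φ.map p ≫ g' = g := by
  have h' : kernel.ι (Φ.map p) ≫ g = 0 := by
    rw [← cancel_epi (kernelComparison p Φ), ← Category.assoc, kernelComparison_comp_ι, h, comp_zero]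
  exact ⟨Abelian.epiDesc (Φ.map p) g h', Abelian.comp_epiDesc _ _ _⟩

end ExactFunctor

/-! ### The right preorder and right cells -/

section Order

variable {C : Type u} [Bicategory.{w, v} C] [∀ a b : C, Preadditive (a ⟶ b)]
  [IsAdditiveTwoCategory C]

lemma rightLE_iff {i a b : C} {F : i ⟶ a} {G : i ⟶ b} :
    RightLE F G ↔ ∃ H : a ⟶ b, Nonempty (Retract G (F ≫ H)) := by
  constructor
  · rintro ⟨H, Z, ⟨e⟩⟩
    exact ⟨H, ⟨⟨biprod.inl ≫ e.inv, e.hom ≫ biprod.fst, by simp⟩⟩⟩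
  · rintro ⟨H, ⟨r⟩⟩
    have := IsAdditiveTwoCategory.isIdempotentComplete i b
    obtain ⟨Z, e, -⟩ := exists_iso_biprod_of_retract r
    exact ⟨H, Z, ⟨e⟩⟩

lemma RightLE.of_retract {i a b : C} {F : i ⟶ a} {G : i ⟶ b} {H : a ⟶ b}
    (r : Retract G (F ≫ H)) : RightLE F G :=
  rightLE_iff.2 ⟨H, ⟨r⟩⟩

lemma RightLE.trans_retract {i a b : C} {F : i ⟶ a} {G G' : i ⟶ b} (h : RightLE F G)
    (r : Retract G' G) : RightLE F G' := by
  obtain ⟨H, ⟨r'⟩⟩ := rightLE_iff.1 h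
  exact .of_retract (r.trans r')

lemma RightLE.comp {i a b c : C} {F : i ⟶ a} {G : i ⟶ b} (h : RightLE F G) (H : b ⟶ c) :
    RightLE F (G ≫ H) := by
  obtain ⟨Y, ⟨r⟩⟩ := rightLE_iff.1 h
  exact .of_retract (H := Y ≫ H) ((r.map (postcomp i H)).trans (Retract.ofIso (α_ F Y H)))

lemma RightLE.trans {i a b c : C} {F : i ⟶ a} {G : i ⟶ b} {H : i ⟶ c} (h : RightLE F G)
    (h' : RightLE G H) : RightLE F H := by
  obtain ⟨Y, ⟨r⟩⟩ := rightLE_iff.1 h'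
  exact (h.comp Y).trans_retract r

lemma RightLE.refl {i a : C} (F : i ⟶ a) : RightLE F F :=
  .of_retract (H := 𝟙 a) (Retract.ofIso (ρ_ F).symm)

lemma IsRightCell.rightLE {i : C} {R : ∀ a : C, Set (i ⟶ a)} (hR : IsRightCell R) {a b : C}
    {F : i ⟶ a} {G : i ⟶ b} (hF : F ∈ R a) (hG : G ∈ R b) : RightLE F G := by
  obtain ⟨_, _, _, h⟩ := hR
  exact ((h _ _).1 hF).2.2.trans ((h _ _).1 hG).2.1

lemma IsRightCell.indecomposable {i : C} {R : ∀ a : C, Set (i ⟶ a)} (hR : IsRightCell R) {a : C}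
    {F : i ⟶ a} (hF : F ∈ R a) : Indecomposable F := by
  obtain ⟨_, _, _, h⟩ := hR
  exact ((h _ _).1 hF).1

lemma IsRightCell.mem {i : C} {R : ∀ a : C, Set (i ⟶ a)} (hR : IsRightCell R) {a b : C}
    {F : i ⟶ a} {G : i ⟶ b} (hF : F ∈ R a) (hG : Indecomposable G) (h₁ : RightLE F G)
    (h₂ : RightLE G F) : G ∈ R b := by
  obtain ⟨_, _, _, h⟩ := hR
  have := (h _ _).1 hF
  exact (h _ _).2 ⟨hG, this.2.1.trans h₁, h₂.trans this.2.2⟩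

lemma IsRightCell.exists_mem {i : C} {R : ∀ a : C, Set (i ⟶ a)} (hR : IsRightCell R) :
    ∃ (a : C) (F : i ⟶ a), F ∈ R a := by
  obtain ⟨a, F, hF, h⟩ := hR
  exact ⟨a, F, (h _ _).2 ⟨hF, .refl F, .refl F⟩⟩

lemma isZero_act_of_retract {i a b : C} {F G : a ⟶ b} (r : Retract G F) {X : Freyd (i ⟶ a)}
    (h : IsZero ((act i F).obj X)) : IsZero ((act i G).obj X) := by
  let r' : Retract ((act i G).obj X) ((act i F).obj X) := r.map (evalFunctor X b)
  have : Mono r'.i := mono_of_mono_fac r'.retract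
  exact IsZero.of_mono r'.i h

lemma IsSimpleOf.exists_epi {i a : C} {G : i ⟶ a} {L : Freyd (i ⟶ a)} (h : IsSimpleOf G L) :
    ∃ p : Freyd.projFunctor.obj G ⟶ L, Epi p := by
  obtain ⟨-, -, p, hp, -⟩ := h
  exact ⟨p, hp⟩

lemma nonempty_retract_of_proj {i a : C} {G H : i ⟶ a}
    (r : Retract (Freyd.projFunctor.obj G) (Freyd.projFunctor.obj H)) : Nonempty (Retract G H) :=
  ⟨⟨Freyd.projFunctor.preimage r.i, Freyd.projFunctor.preimage r.r,
    Freyd.projFunctor.map_injective (by simp)⟩⟩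

variable [Bicategory.Strict C]

/-- `G X` is a summand of `H (F X)`. Hence all members of a right cell annihilate the same modules.
-/
lemma RightLE.isZero_act {i a b : C} {F : i ⟶ a} {G : i ⟶ b} (h : RightLE F G)
    {X : Freyd (i ⟶ i)} (hX : IsZero ((act i F).obj X)) : IsZero ((act i G).obj X) := by
  obtain ⟨H, ⟨r⟩⟩ := rightLE_iff.1 h
  exact isZero_act_of_retract r (IsZero.of_iso ((act i H).map_isZero hX) (actCompIso F H X))

end Order

/-! ### Adjoints of indecomposable 1-morphisms -/

section Adjoint

variable {C : Type u} [Bicategory.{w, v} C] [∀ a b : C, Preadditive (a ⟶ b)]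
  [IsAdditiveTwoCategory C]

/-- Taking mates turns a retract of `H'` into a retract of `H`, so the left adjoint `H'` inherits
the absence of proper nonzero summands. -/
lemma retract_comp_eq_id_of_adjoint_indecomposable {a b : C} {H : a ⟶ b} {H' G : b ⟶ a}
    {G' : a ⟶ b} (adj : H' ⊣ H) (adjG : G ⊣ G') (hH : Indecomposable H) (hG : ¬ IsZero G)
    (r : Retract G H') : r.r ≫ r.i = 𝟙 H' := by
  have := IsAdditiveTwoCategory.isIdempotentComplete a b
  let r' : Retract G' H :=
    ⟨Bicategory.conjugateEquiv adjG adj r.r, Bicategory.conjugateEquiv adj adjG r.i, by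
      rw [Bicategory.conjugateEquiv_comp, r.retract, Bicategory.conjugateEquiv_id]⟩
  have hG' : ¬ IsZero G' := fun h => hG <| by
    rw [IsZero.iff_id_eq_zero]
    exact (Bicategory.conjugateEquiv adjG adjG).injective (h.eq_of_src _ _)
  have h := retract_comp_eq_id_of_indecomposable r' hH hG'
  apply (Bicategory.conjugateEquiv adj adj).injective
  rw [Bicategory.conjugateEquiv_id, ← Bicategory.conjugateEquiv_comp adj adjG adj]
  exact h

end Adjoint

/-! ### The minimal submodule attached to a 1-morphism -/

section CellKernel

variable {C : Type u} [Bicategory.{w, v} C] [∀ a b : C, Preadditive (a ⟶ b)]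
  [IsAdditiveTwoCategory C] [Bicategory.Strict C] [HasFiatProperties C]

/-- The projective `P_{𝟙 i}`. -/
abbrev unitProj (i : C) : Freyd (i ⟶ i) := Freyd.projFunctor.obj (𝟙 i)

/-- `m : K ⟶ P_{𝟙 i}` is the smallest subobject such that `F` annihilates the quotient; it is
covered by `F' F P_{𝟙 i}` for some `F'`. -/
structure IsCellKernel {i a : C} (F : i ⟶ a) {K : Freyd (i ⟶ i)} (m : K ⟶ unitProj i) :
    Prop where
  mono : Mono m
  isIso : IsIso ((act i F).map m)
  minimal : ∀ {M : Freyd (i ⟶ i)} (n : M ⟶ unitProj i), Mono n → IsIso ((act i F).map n) →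
    ∃ t : K ⟶ M, t ≫ n = m
  cover : ∃ (F' : a ⟶ i) (e : (act i F').obj ((act i F).obj (unitProj i)) ⟶ K), Epi e

/-- Take the image of the counit `F'F P_𝟙 ⟶ P_𝟙` for `F'` left adjoint to `F`. A triangle identity
makes `F` of the counit epi, so `F` inverts the inclusion of the image. -/
lemma exists_isCellKernel {i a : C} (F : i ⟶ a) :
    ∃ (K : Freyd (i ⟶ i)) (m : K ⟶ unitProj i), IsCellKernel F m := by
  obtain ⟨F', -, ⟨adj⟩⟩ := HasFiatProperties.exists_biadjoint F
  let A := actAdjunction i adj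
  let c := A.counit.app (unitProj i)
  have hc : Epi ((act i F).map c) :=
    epi_of_epi_fac (A.right_triangle_components (unitProj i))
  have hfac : (act i F).map (factorThruImage c) ≫ (act i F).map (image.ι c) =
      (act i F).map c := by rw [← Functor.map_comp, image.fac]
  have hepi : Epi ((act i F).map (image.ι c)) := epi_of_epi_fac hfac
  refine ⟨image c, image.ι c, inferInstance, isIso_of_mono_of_epi _, fun {M} n hn hi => ?_,
    F', factorThruImage c, inferInstance⟩
  -- By naturality the counit factors through every `n` that `F` inverts, hence so does its image.
  have h : (act i F').map (inv ((act i F).map n)) ≫ A.counit.app M ≫ n = c := by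
    have := A.counit.naturality n
    rw [Functor.comp_map, Functor.id_map] at this
    rw [← this, ← Functor.map_comp_assoc, IsIso.inv_hom_id, CategoryTheory.Functor.map_id,
      Category.id_comp]
  let S : MonoFactorisation c :=
    { I := M, m := n, e := (act i F').map (inv ((act i F).map n)) ≫ A.counit.app M
      fac := by rw [Category.assoc, h] }
  exact ⟨image.lift S, image.lift_fac S⟩

variable {i a : C} {F : i ⟶ a} {K : Freyd (i ⟶ i)} {m : K ⟶ unitProj i}

/-- If `F` killed `T`, it would invert the inclusion of `kernel q`, and minimality would give
`kernel q = K`. -/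
lemma IsCellKernel.not_isZero (h : IsCellKernel F m) {T : Freyd (i ⟶ i)} (q : K ⟶ T) (hq : q ≠ 0) :
    ¬ IsZero ((act i F).obj T) := by
  intro hT
  have := h.mono
  have := h.isIso
  have := isIso_map_kernel_ι (act i F) q hT
  obtain ⟨t, ht⟩ := h.minimal (kernel.ι q ≫ m) (mono_comp _ _) (by
    rw [Functor.map_comp]; infer_instance)
  have ht' : t ≫ kernel.ι q = 𝟙 K := by
    rw [← cancel_mono m, Category.assoc, ht, Category.id_comp]
  apply hq
  rw [← Category.id_comp q, ← ht', Category.assoc, kernel.condition, comp_zero]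

/-- The minimal `K` lies in `K'` with quotient killed by `F`. If this quotient were nonzero it would
have the top `L` of `K'` as a quotient, but `F L ≠ 0`; so the two submodules agree. -/
lemma IsCellKernel.of_hasSimpleTop (h : IsCellKernel F m) {K' L : Freyd (i ⟶ i)}
    (m' : K' ⟶ unitProj i) [Mono m'] (hm' : IsIso ((act i F).map m')) (hL : HasSimpleTop K' L)
    (hFL : ¬ IsZero ((act i F).obj L)) : IsCellKernel F m' := by
  obtain ⟨t, ht⟩ := h.minimal m' inferInstance hm'
  have := h.mono
  have := h.isIso
  have hmt : Mono t := mono_of_mono_fac ht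
  have hFt : IsIso ((act i F).map t) := by
    have : (act i F).map t ≫ (act i F).map m' = (act i F).map m := by
      rw [← Functor.map_comp, ht]
    exact IsIso.of_isIso_fac_right this
  have hepi : Epi t := by
    by_contra hne
    have hz : ¬ IsZero (cokernel t) := fun hz => hne (Preadditive.epi_of_isZero_cokernel t hz)
    obtain ⟨T, q, hT, hq⟩ := exists_simple_quotient hz
    obtain ⟨-, p, hp, hp'⟩ := hL
    obtain ⟨e, -⟩ := hp' T (cokernel.π t ≫ q) hT (epi_comp _ _)
    have h0 : IsZero ((act i F).obj (cokernel t)) :=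
      (isIso_map_iff_isZero_cokernel (act i F) t).1 hFt
    exact hFL (IsZero.of_iso (IsZero.of_epi ((act i F).map q) h0) ((act i F).mapIso e))
  have : IsIso t := isIso_of_mono_of_epi t
  refine ⟨inferInstance, hm', fun n hn hi => ?_, ?_⟩
  · obtain ⟨s, hs⟩ := h.minimal n hn hi
    exact ⟨inv t ≫ s, by rw [Category.assoc, hs, ← ht, IsIso.inv_hom_id_assoc]⟩
  · obtain ⟨F', e, he⟩ := h.cover
    exact ⟨F', e ≫ t, epi_comp _ _⟩

/-- `F` kills no simple quotient of `K`. For two different ones `p`, `q`, the kernel of `p` surjects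
under `q`; applying `F` contradicts `not_epi_of_local` in `F K ≅ P_F`. -/
lemma IsCellKernel.exists_hasSimpleTop (h : IsCellKernel F m) (hF : Indecomposable F) :
    ∃ L, HasSimpleTop K L := by
  have := h.mono
  have := h.isIso
  have := HasFiatProperties.isLocalRing_end F hF
  let e : Freyd.projFunctor.obj F ≅ (act i F).obj K :=
    (actProjIdIso F).symm ≪≫ (asIso ((act i F).map m)).symm
  have hK : ¬ IsZero K := fun hz => by
    have h0 : IsZero (Freyd.projFunctor.obj F) := IsZero.of_iso ((act i F).map_isZero hz) e
    have : 𝟙 F = 0 := Freyd.projFunctor.map_injective (h0.eq_of_src _ _)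
    exact hF.1 ((IsZero.iff_id_eq_zero _).2 this)
  obtain ⟨L, p, hL, hp⟩ := exists_simple_quotient hK
  have hne : ∀ {T : Freyd (i ⟶ i)} (q : K ⟶ T), Simple T → Epi q →
      q ≠ 0 ∧ e.hom ≫ (act i F).map q ≠ 0 := fun {T} q hT hq => by
    have hq₀ : q ≠ 0 := fun h0 => Simple.not_isZero T (IsZero.of_epi_eq_zero q h0)
    refine ⟨hq₀, fun h0 => h.not_isZero q hq₀ ?_⟩
    exact IsZero.of_epi_eq_zero (e.hom ≫ (act i F).map q) h0
  refine ⟨L, hL, p, hp, fun T q hT hq => ?_⟩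
  have hk : kernel.ι p ≫ q = 0 := by
    by_contra hn
    have : Epi (kernel.ι p ≫ q) := epi_of_nonzero_to_simple hn
    refine not_epi_of_local _ (hne p hL hp).2 _ (hne q hT hq).2
      ((act i F).map (kernel.ι p) ≫ e.inv) ?_ ?_
    · rw [Category.assoc, e.inv_hom_id_assoc, ← Functor.map_comp, kernel.condition,
        Functor.map_zero]
    · rw [Category.assoc, e.inv_hom_id_assoc, ← Functor.map_comp]
      infer_instance
  have hfac : p ≫ Abelian.epiDesc p q hk = q := Abelian.comp_epiDesc p q hk
  have : IsIso (Abelian.epiDesc p q hk) := isIso_of_hom_simple fun h₀ => (hne q hT hq).1 (by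
    rw [← hfac, h₀, comp_zero])
  exact ⟨asIso (Abelian.epiDesc p q hk), hfac⟩

lemma exists_isSimpleOf (L : Freyd (i ⟶ a)) [Simple L] : ∃ G : i ⟶ a, IsSimpleOf G L := by
  obtain ⟨G, p, hG, hp⟩ := HasFiatProperties.exists_indecomposable (Simple.not_isZero L)
  have := HasFiatProperties.isLocalRing_end G hG
  have : Epi p := epi_of_nonzero_to_simple hp
  have h : HasSimpleTop (Freyd.projFunctor.obj G) L := hasSimpleTop_of_local p
  exact ⟨G, hG, h⟩

/-- The 1-morphism `G` with `L ≅ L_G` is above `F` in the right order. -/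
lemma IsCellKernel.rightLE (h : IsCellKernel F m) {L : Freyd (i ⟶ i)} (hL : HasSimpleTop K L)
    {G : i ⟶ i} (hG : IsSimpleOf G L) : RightLE F G := by
  obtain ⟨F', c, hc⟩ := h.cover
  obtain ⟨hS, p, hp, -⟩ := hL
  obtain ⟨q, hq⟩ := hG.exists_epi
  have := HasFiatProperties.isLocalRing_end G hG.1
  -- `L` is a quotient of `K`, hence of the projective indexed by `F ≫ F'`, so `P_G` is a summand of
  -- the latter.
  let e : Freyd.projFunctor.obj (F ≫ F') ≅ (act i F').obj ((act i F).obj (unitProj i)) :=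
    (actProjIdIso (F ≫ F')).symm ≪≫ actCompIso F F' (unitProj i)
  have : Epi (e.hom ≫ c ≫ p) := inferInstance
  obtain ⟨r⟩ := nonempty_retract_of_local q (e.hom ≫ c ≫ p)
  obtain ⟨r'⟩ := nonempty_retract_of_proj r
  exact .of_retract r'

/-- The cover `P_G ⟶ L` lifts to `P_G ⟶ K`, which is epi because `K` has simple top. Applying `F`
gives an epimorphism from the projective of `G ≫ F` onto `F K ≅ P_F`, and it splits. -/
lemma IsCellKernel.rightLE_symm (h : IsCellKernel F m) {L : Freyd (i ⟶ i)} (hL : HasSimpleTop K L)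
    {G : i ⟶ i} (hG : IsSimpleOf G L) : RightLE G F := by
  have := h.isIso
  obtain ⟨hS, p, hp, hp'⟩ := hL
  obtain ⟨q, hq⟩ := hG.exists_epi
  let g := Projective.factorThru q p
  have hg : g ≫ p = q := Projective.factorThru_comp q p
  have : Epi g := by
    by_contra hne
    have hz : ¬ IsZero (cokernel g) := fun hz => hne (Preadditive.epi_of_isZero_cokernel g hz)
    obtain ⟨T, s, hT, hs⟩ := exists_simple_quotient hz
    obtain ⟨e, he⟩ := hp' T (cokernel.π g ≫ s) hT (epi_comp _ _)
    have h0 : q ≫ e.hom = 0 := by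
      rw [← hg, Category.assoc, he, cokernel.condition_assoc, zero_comp]
    have : q = 0 := by rw [← cancel_mono e.hom, h0, zero_comp]
    exact Simple.not_isZero L (IsZero.of_epi_eq_zero q this)
  let s : Freyd.projFunctor.obj (G ≫ F) ⟶ Freyd.projFunctor.obj F :=
    (actProjIso G F).inv ≫ (act i F).map g ≫ (act i F).map m ≫ (actProjIdIso F).hom
  have : Epi s := inferInstance
  obtain ⟨r⟩ := nonempty_retract_of_proj (G := F) (H := G ≫ F)
    ⟨Projective.factorThru (𝟙 _) s, s, Projective.factorThru_comp _ _⟩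
  exact .of_retract r

/-- If `H` is above `F` and does not annihilate the simple top `L` of the cell kernel of `F`,
then it has the same cell kernel. -/
lemma IsCellKernel.of_rightLE (h : IsCellKernel F m) {L : Freyd (i ⟶ i)} (hL : HasSimpleTop K L)
    {b : C} {H : i ⟶ b} (hFH : RightLE F H) (hHL : ¬ IsZero ((act i H).obj L)) :
    IsCellKernel H m := by
  obtain ⟨K', m', h'⟩ := exists_isCellKernel H
  have := h.mono
  refine h'.of_hasSimpleTop m ?_ hL hHL
  rw [isIso_map_iff_isZero_cokernel]
  exact hFH.isZero_act ((isIso_map_iff_isZero_cokernel (act i F) m).1 h.isIso)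

end CellKernel

/-! ### The simple top of the cell submodule and the vanishing on its radical -/

section CellTop

variable {C : Type u} [Bicategory.{w, v} C] [∀ a b : C, Preadditive (a ⟶ b)]
  [IsAdditiveTwoCategory C] [Bicategory.Strict C] [HasFiatProperties C]

/-- The submodule `K` of `P_{𝟙 i}` attached to the right cell `R`, with its simple top
`L ≅ L_G`. -/
structure IsCellTop {i : C} (R : ∀ a : C, Set (i ⟶ a)) {K L : Freyd (i ⟶ i)} (m : K ⟶ unitProj i)
    (p : K ⟶ L) (G : i ⟶ i) : Prop where
  isRightCell : IsRightCell R
  isCellKernel {a : C} {F : i ⟶ a} (hF : F ∈ R a) : IsCellKernel F m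
  hasSimpleTop : HasSimpleTop K L
  epi : Epi p
  isSimpleOf : IsSimpleOf G L

namespace IsCellTop

variable {i : C} {R : ∀ a : C, Set (i ⟶ a)} {K L : Freyd (i ⟶ i)} {m : K ⟶ unitProj i}
  {p : K ⟶ L} {G : i ⟶ i}

lemma not_isZero (h : IsCellTop R m p G) {a : C} {F : i ⟶ a} (hF : F ∈ R a) :
    ¬ IsZero ((act i F).obj L) := by
  have := h.epi
  have := h.hasSimpleTop.1
  refine (h.isCellKernel hF).not_isZero p fun h₀ => Simple.not_isZero L (IsZero.of_epi_eq_zero p h₀)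

lemma mem (h : IsCellTop R m p G) : G ∈ R i := by
  obtain ⟨a, F, hF⟩ := h.isRightCell.exists_mem
  exact h.isRightCell.mem hF h.isSimpleOf.1
    ((h.isCellKernel hF).rightLE h.hasSimpleTop h.isSimpleOf)
    ((h.isCellKernel hF).rightLE_symm h.hasSimpleTop h.isSimpleOf)

/-- Such an `H` has the same minimal submodule, so `G` is above `H`, which closes the cycle through
`F`. -/
lemma mem_of_rightLE (h : IsCellTop R m p G) {a b : C} {F : i ⟶ a} (hF : F ∈ R a) {H : i ⟶ b}
    (hH : Indecomposable H) (hFH : RightLE F H) (hHL : ¬ IsZero ((act i H).obj L)) :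
    H ∈ R b := by
  have hK := (h.isCellKernel hF).of_rightLE h.hasSimpleTop hFH hHL
  exact h.isRightCell.mem hF hH hFH ((hK.rightLE h.hasSimpleTop h.isSimpleOf).trans
    (h.isRightCell.rightLE h.mem hF))

/-- Otherwise the transpose `f' : H' P_𝟙 ⟶ L`, with `H'` left adjoint to `H`, is already onto on
`H'` of the kernel of `p`. This forces `H' ≅ G`, so `H' P_𝟙` is local. But that submodule is proper,
having zero image in `H' L ≠ 0`, so it cannot surject onto the top. -/
lemma comp_eq_zero_of_indecomposable (h : IsCellTop R m p G) {H : i ⟶ i} (hH : Indecomposable H)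
    (f : unitProj i ⟶ (act i H).obj L) : kernel.ι p ≫ m ≫ f = 0 := by
  have hL := h.hasSimpleTop.1
  have hp := h.epi
  by_contra hne
  obtain ⟨H', -, ⟨adj⟩⟩ := HasFiatProperties.exists_biadjoint H
  obtain ⟨G', ⟨adjG⟩, -⟩ := HasFiatProperties.exists_biadjoint G
  let A := actAdjunction i adj
  let f' : (act i H').obj (unitProj i) ⟶ L := (A.homEquiv _ _).symm f
  have hf' : (act i H').map (kernel.ι p ≫ m) ≫ f' ≠ 0 := fun h₀ => hne <| by
    have h₁ := A.homEquiv_naturality_left (kernel.ι p ≫ m) f'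
    rw [h₀, Equiv.apply_symm_apply, Category.assoc] at h₁
    rw [← h₁, A.homEquiv_unit, Functor.map_zero, comp_zero]
  have hf₀ : f' ≠ 0 := fun h₀ => hf' (by rw [h₀, comp_zero])
  have hfe : Epi f' := epi_of_nonzero_to_simple hf₀
  obtain ⟨q, hq⟩ := h.isSimpleOf.exists_epi
  have := HasFiatProperties.isLocalRing_end G h.isSimpleOf.1
  have : Epi ((actProjIdIso H').inv ≫ f') := epi_comp _ _
  obtain ⟨r⟩ := nonempty_retract_of_local q ((actProjIdIso H').inv ≫ f')
  obtain ⟨r⟩ := nonempty_retract_of_proj r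
  -- `G` is a nonzero summand of the left adjoint of an indecomposable, hence all of it.
  have hr := retract_comp_eq_id_of_adjoint_indecomposable adj adjG hH h.isSimpleOf.1.1 r
  have hm := h.isCellKernel h.mem
  have := hm.mono
  have hH'm : IsIso ((act i H').map m) := by
    rw [isIso_map_iff_isZero_cokernel]
    exact isZero_act_of_retract (⟨r.r, r.i, hr⟩ : Retract H' G)
      ((isIso_map_iff_isZero_cokernel (act i G) m).1 hm.isIso)
  have hH'L : ¬ IsZero ((act i H').obj L) := fun hz =>
    h.not_isZero h.mem (isZero_act_of_retract r hz)
  let e : Freyd.projFunctor.obj G ≅ (act i H').obj (unitProj i) :=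
    Freyd.projFunctor.mapIso ⟨r.i, r.r, r.retract, hr⟩ ≪≫ (actProjIdIso H').symm
  have hepi : Epi ((act i H').map (kernel.ι p ≫ m) ≫ f') := epi_of_nonzero_to_simple hf'
  refine not_epi_of_local (e.hom ≫ inv ((act i H').map m) ≫ (act i H').map p) (fun h₀ => ?_)
    (e.hom ≫ f') (fun h₀ => ?_) ((act i H').map (kernel.ι p ≫ m) ≫ e.inv) ?_ ?_
  · exact hH'L (IsZero.of_epi_eq_zero _ h₀)
  · exact hf₀ (by rw [← cancel_epi e.hom, h₀, comp_zero])
  · rw [Category.assoc, e.inv_hom_id_assoc, Functor.map_comp, Category.assoc,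
      IsIso.hom_inv_id_assoc, ← Functor.map_comp, kernel.condition, Functor.map_zero]
  · rwa [Category.assoc, e.inv_hom_id_assoc]

lemma comp_eq_zero (h : IsCellTop R m p G) {X : i ⟶ i} (f : unitProj i ⟶ (act i X).obj L) :
    kernel.ι p ≫ m ≫ f = 0 := by
  revert f
  refine HasFiatProperties.induction (P := fun X : i ⟶ i =>
    ∀ f : unitProj i ⟶ (evalFunctor L i).obj X, kernel.ι p ≫ m ≫ f = 0) ?_ ?_ ?_ X
  · intro X hX f
    exact ((evalFunctor L i).map_isZero hX).eq_of_tgt _ _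
  · intro H hH f
    exact h.comp_eq_zero_of_indecomposable hH f
  · intro X Y Z e hY hZ f
    let Φ := evalFunctor L i
    have hY' := hY (f ≫ Φ.map (e.hom ≫ biprod.fst))
    have hZ' := hZ (f ≫ Φ.map (e.hom ≫ biprod.snd))
    rw [← Category.comp_id f, ← Φ.map_id, id_eq_of_iso_biprod e, Functor.map_add,
      Φ.map_comp (e.hom ≫ biprod.fst), Φ.map_comp (e.hom ≫ biprod.snd), Preadditive.comp_add,
      Preadditive.comp_add, Preadditive.comp_add, ← Category.assoc f, ← Category.assoc m,
      ← Category.assoc (kernel.ι p), hY', zero_comp, zero_add, ← Category.assoc f,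
      ← Category.assoc m, ← Category.assoc (kernel.ι p), hZ', zero_comp]

/-- Every morphism from `F P_{𝟙 i}` to `H L` annihilates the image of the radical of `K`. -/
lemma map_comp_eq_zero (h : IsCellTop R m p G) {a : C} (F H : i ⟶ a)
    (f : (act i F).obj (unitProj i) ⟶ (act i H).obj L) :
    (act i F).map (kernel.ι p ≫ m) ≫ f = 0 := by
  -- Transposing `F` to the right turns `f` into a morphism from `P_𝟙` to `F' (H L)`. The 1-morphism
  -- `H ≫ F'` may be decomposable, so the previous lemma is needed for all 1-morphisms.
  obtain ⟨F', ⟨adj⟩, -⟩ := HasFiatProperties.exists_biadjoint F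
  let A := actAdjunction i adj
  have h₁ := h.comp_eq_zero (X := H ≫ F') (A.homEquiv _ _ f ≫ (actCompIso H F' L).inv)
  rw [← Category.assoc m, ← Category.assoc, ← Category.assoc, Preadditive.IsIso.comp_right_eq_zero,
    ← A.homEquiv_naturality_left] at h₁
  apply (A.homEquiv _ _).injective
  rw [h₁, A.homEquiv_unit, Functor.map_zero, comp_zero]

end IsCellTop

end CellTop

/-! ### Closure properties of the additive closure -/

section AddClosure

variable {D : Type v'} [Category.{w'} D] [Preadditive D] [HasFiniteBiproducts D]
  {Q : ObjectProperty D}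

lemma addClosure_iff {X : D} : addClosure Q X ↔ ∃ (n : ℕ) (Y : Fin n → D)
    (s : ∀ j, X ⟶ Y j) (t : ∀ j, Y j ⟶ X), (∀ j, Q (Y j)) ∧ ∑ j, s j ≫ t j = 𝟙 X := by
  constructor
  · rintro ⟨n, Y, b, hY, ⟨hb⟩, ⟨r⟩⟩
    refine ⟨n, Y, fun j => r.i ≫ b.π j, fun j => b.ι j ≫ r.r, hY, ?_⟩
    have h : ∀ j, (r.i ≫ b.π j) ≫ b.ι j ≫ r.r = r.i ≫ (b.π j ≫ b.ι j) ≫ r.r := fun j => by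
      simp only [Category.assoc]
    simp_rw [h]
    rw [← Preadditive.comp_sum, ← Preadditive.sum_comp, IsBilimit.total hb, Category.id_comp,
      r.retract]
  · rintro ⟨n, Y, s, t, hY, h⟩
    exact ⟨n, Y, biproduct.bicone Y, hY, ⟨biproduct.isBilimit Y⟩,
      ⟨⟨biproduct.lift s, biproduct.desc t, by rw [← h]; exact biproduct.lift_desc⟩⟩⟩

lemma addClosure_of_fintype {ι : Type*} [Fintype ι] {X : D} (Y : ι → D) (s : ∀ j, X ⟶ Y j)
    (t : ∀ j, Y j ⟶ X) (hY : ∀ j, Q (Y j)) (h : ∑ j, s j ≫ t j = 𝟙 X) : addClosure Q X := by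
  let e := Fintype.equivFin ι
  refine addClosure_iff.2 ⟨Fintype.card ι, fun j => Y (e.symm j), fun j => s (e.symm j),
    fun j => t (e.symm j), fun j => hY _, ?_⟩
  rw [← h]
  exact Equiv.sum_comp e.symm fun j => s j ≫ t j

lemma addClosure_of_mem {X : D} (h : Q X) : addClosure Q X :=
  addClosure_of_fintype (ι := Unit) (fun _ => X) (fun _ => 𝟙 X) (fun _ => 𝟙 X) (fun _ => h)
    (by simp)

lemma addClosure_of_isZero {X : D} (h : IsZero X) : addClosure Q X :=
  addClosure_of_fintype (ι := Empty) (fun _ => X) (fun _ => 𝟙 X) (fun _ => 𝟙 X) Empty.rec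
    (h.eq_of_src _ _)

lemma addClosure_of_sum {ι : Type*} [Fintype ι] {X : D} (Y : ι → D) (s : ∀ j, X ⟶ Y j)
    (t : ∀ j, Y j ⟶ X) (hY : ∀ j, addClosure Q (Y j)) (h : ∑ j, s j ≫ t j = 𝟙 X) :
    addClosure Q X := by
  choose n Z s' t' hZ h' using fun j => addClosure_iff.1 (hY j)
  refine addClosure_of_fintype (ι := Σ j, Fin (n j)) (fun x => Z x.1 x.2)
    (fun x => s x.1 ≫ s' x.1 x.2) (fun x => t' x.1 x.2 ≫ t x.1) (fun x => hZ _ _) ?_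
  rw [Fintype.sum_sigma, ← h]
  refine Finset.sum_congr rfl fun j _ => ?_
  have e : ∀ l, (s j ≫ s' j l) ≫ t' j l ≫ t j = s j ≫ (s' j l ≫ t' j l) ≫ t j := fun l => by
    simp only [Category.assoc]
  simp_rw [e]
  rw [← Preadditive.comp_sum, ← Preadditive.sum_comp, h', Category.id_comp]

lemma addClosure_of_retract {X Y : D} (r : Retract X Y) (hY : addClosure Q Y) : addClosure Q X :=
  addClosure_of_sum (ι := Unit) (fun _ => Y) (fun _ => r.i) (fun _ => r.r) (fun _ => hY) (by simp)

lemma addClosure_of_iso_biprod {X Y Z : D} (e : X ≅ Y ⊞ Z) (hY : addClosure Q Y)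
    (hZ : addClosure Q Z) : addClosure Q X := by
  refine addClosure_of_sum (ι := Bool) (fun b => bif b then Y else Z)
    (fun b => match b with | true => e.hom ≫ biprod.fst | false => e.hom ≫ biprod.snd)
    (fun b => match b with | true => biprod.inl ≫ e.inv | false => biprod.inr ≫ e.inv) ?_ ?_
  · rintro (_ | _)
    exacts [hZ, hY]
  · rw [Fintype.sum_bool]
    exact (id_eq_of_iso_biprod e).symm

omit [HasFiniteBiproducts D] in
lemma isCokernelOf_zero_id (X : D) : IsCokernelOf (0 : X ⟶ X) (𝟙 X) :=
  ⟨by simp, ⟨CokernelCofork.IsColimit.ofId _ rfl⟩⟩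

omit [HasFiniteBiproducts D] in
lemma presentedBy_of_addClosure {X : D} (h : addClosure Q X) : presentedBy Q X :=
  ⟨X, X, 0, 𝟙 X, h, h, isCokernelOf_zero_id X⟩

lemma isSummandOfPower_of_addClosure {X Z : D} (hQ : ∀ Y, Q Y → Nonempty (Retract Y Z))
    (h : addClosure Q X) : IsSummandOfPower Z X := by
  obtain ⟨n, Y, s, t, hY, e⟩ := addClosure_iff.1 h
  have r : ∀ j, Retract (Y j) Z := fun j => (hQ (Y j) (hY j)).some
  refine ⟨n, fun j => s j ≫ (r j).i, fun j => (r j).r ≫ t j, ?_⟩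
  rw [← e]
  refine Finset.sum_congr rfl fun j _ => ?_
  rw [Category.assoc, Retract.retract_assoc]

end AddClosure

/-! ### Relative presentations in full subcategories -/

section FullSubcategory

variable {D : Type v'} [Category.{w'} D] [Preadditive D]

lemma IsRelativePresentation.of_hom {P : ObjectProperty D} {Q X₁ X₀ M : P.FullSubcategory}
    {d : X₁ ⟶ X₀} {p : X₀ ⟶ M} (h : IsRelativePresentation Q.obj d.hom p.hom) :
    IsRelativePresentation Q d p := by
  have hs : ∀ X : P.FullSubcategory, IsSummandOfPower Q.obj X.obj → IsSummandOfPower Q X := by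
    rintro X ⟨n, s, t, e⟩
    refine ⟨n, fun j => ObjectProperty.homMk (s j), fun j => ObjectProperty.homMk (t j), ?_⟩
    apply ObjectProperty.hom_ext
    rw [← ObjectProperty.ι_map, Functor.map_sum]
    exact e
  refine ⟨hs _ h.summand₁, hs _ h.summand₀, ObjectProperty.hom_ext _ h.w, fun g hg => ?_,
    fun g hg => ?_, fun f => ?_, fun g hg => ?_⟩
  · exact ObjectProperty.hom_ext _ (h.epi g.hom (congrArg (fun t => t.hom) hg))
  · obtain ⟨h', e⟩ := h.desc g.hom (congrArg (fun t => t.hom) hg)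
    exact ⟨ObjectProperty.homMk h', ObjectProperty.hom_ext _ e⟩
  · obtain ⟨h', e⟩ := h.lift f.hom
    exact ⟨ObjectProperty.homMk h', ObjectProperty.hom_ext _ e⟩
  · obtain ⟨h', e⟩ := h.exact g.hom (congrArg (fun t => t.hom) hg)
    exact ⟨ObjectProperty.homMk h', ObjectProperty.hom_ext _ e⟩

end FullSubcategory

/-! ### Cokernel presentations and relative projectivity -/

section RelativelyProjective

variable {D : Type v'} [Category.{w'} D] [Abelian D]

lemma isRelativePresentation_of_isCokernelOf {Q X₁ X₀ M : D} {d : X₁ ⟶ X₀} {p : X₀ ⟶ M}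
    (h : IsCokernelOf d p) (h₁ : IsSummandOfPower Q X₁) (h₀ : IsSummandOfPower Q X₀)
    (lift : ∀ {X N : D} (e : X ⟶ N), IsSummandOfPower Q X → Epi e → ∀ f : Q ⟶ N,
      ∃ g : Q ⟶ X, g ≫ e = f) : IsRelativePresentation Q d p := by
  obtain ⟨w, ⟨hc⟩⟩ := h
  have hp : Epi p := epi_of_isColimit_cofork hc
  refine ⟨h₁, h₀, w, fun g hg => (cancel_epi p).1 (hg.trans comp_zero.symm), fun g hg => ?_,
    fun f => lift p h₀ hp f, fun g hg => ?_⟩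
  · exact ⟨hc.desc (CokernelCofork.ofπ g hg), hc.fac _ WalkingParallelPair.one⟩
  -- Since `p` is a cokernel of `d`, the map from `X₁` to the kernel of `p` is epi; relative
  -- projectivity is applied to it.
  · let S := ShortComplex.mk d p w
    have hex : Epi S.toCycles := S.exact_iff_epi_toCycles.1 (S.exact_of_g_is_cokernel hc)
    obtain ⟨g', hg'⟩ := lift S.toCycles h₁ hex (S.liftCycles g hg)
    exact ⟨g', by
      have := congrArg (· ≫ S.iCycles) hg'
      simpa [S] using this⟩

end RelativelyProjective

/-! ### Relative projectivity, stability and the module category -/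

section CellCategory

variable {C : Type u} [Bicategory.{w, v} C] [∀ a b : C, Preadditive (a ⟶ b)]
  [IsAdditiveTwoCategory C] [Bicategory.Strict C] [HasFiatProperties C]
  {i : C} {R : ∀ a : C, Set (i ⟶ a)} {K L : Freyd (i ⟶ i)} {m : K ⟶ unitProj i}
  {p : K ⟶ L} {G : i ⟶ i}

omit [Bicategory.Strict C] in
instance (a b : C) : HasFiniteBiproducts (Freyd (a ⟶ b)) :=
  Abelian.hasFiniteBiproducts

/-- The objects `F L` with `F ∈ R`. -/
def cellObjects (R : ∀ a : C, Set (i ⟶ a)) (L : Freyd (i ⟶ i)) (a : C) :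
    ObjectProperty (Freyd (i ⟶ a)) :=
  fun X => ∃ F ∈ R a, X = (act i F).obj L

namespace IsCellTop

/-- Pull `f` back to the projective `F P_𝟙 ≅ F K` and lift it there. The lift kills `F` of the
kernel of `p`, because its components map to modules `H L`, so it descends to `F L`. -/
lemma exists_lift_act (h : IsCellTop R m p G) {a : C} {F : i ⟶ a} (hF : F ∈ R a)
    {X N : Freyd (i ⟶ a)} (e : X ⟶ N) [Epi e] (hX : addClosure (cellObjects R L a) X)
    (f : (act i F).obj L ⟶ N) : ∃ g : (act i F).obj L ⟶ X, g ≫ e = f := by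
  have := h.epi
  have := (h.isCellKernel hF).isIso
  have : Projective ((act i F).obj (unitProj i)) :=
    Projective.of_iso (actProjIdIso F).symm inferInstance
  let g₀ := Projective.factorThru (inv ((act i F).map m) ≫ (act i F).map p ≫ f) e
  have hg₀ : g₀ ≫ e = inv ((act i F).map m) ≫ (act i F).map p ≫ f :=
    Projective.factorThru_comp _ _
  have hz : (act i F).map (kernel.ι p) ≫ (act i F).map m ≫ g₀ = 0 := by
    obtain ⟨n, Y, s, t, hY, hst⟩ := addClosure_iff.1 hX
    rw [← Category.comp_id g₀, ← hst, Preadditive.comp_sum, Preadditive.comp_sum,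
      Preadditive.comp_sum]
    refine Finset.sum_eq_zero fun j _ => ?_
    obtain ⟨H, -, hH⟩ := hY j
    have := h.map_comp_eq_zero F H (g₀ ≫ s j ≫ eqToHom hH)
    rw [← Category.assoc, ← Category.assoc, Preadditive.IsIso.comp_right_eq_zero,
      Functor.map_comp, Category.assoc, Category.assoc] at this
    have h' : (act i F).map (kernel.ι p) ≫ (act i F).map m ≫ g₀ ≫ s j ≫ t j =
        ((act i F).map (kernel.ι p) ≫ (act i F).map m ≫ g₀ ≫ s j) ≫ t j := by
      simp only [Category.assoc]
    rw [h', this, zero_comp]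
  obtain ⟨g, hg⟩ := exists_map_epi_desc (act i F) p ((act i F).map m ≫ g₀) hz
  refine ⟨g, ?_⟩
  rw [← cancel_epi ((act i F).map p), ← Category.assoc, hg, Category.assoc, hg₀,
    IsIso.hom_inv_id_assoc]

lemma exists_lift (h : IsCellTop R m p G) {a : C}
    {Q X N : Freyd (i ⟶ a)} (hQ : addClosure (cellObjects R L a) Q) (e : X ⟶ N) [Epi e]
    (hX : addClosure (cellObjects R L a) X) (f : Q ⟶ N) : ∃ g : Q ⟶ X, g ≫ e = f := by
  obtain ⟨n, Y, s, t, hY, hst⟩ := addClosure_iff.1 hQ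
  have H : ∀ j, ∃ g : Y j ⟶ X, g ≫ e = t j ≫ f := fun j => by
    obtain ⟨F, hF, hFY⟩ := hY j
    obtain ⟨g, hg⟩ := h.exists_lift_act hF e hX (eqToHom hFY.symm ≫ t j ≫ f)
    exact ⟨eqToHom hFY ≫ g, by rw [Category.assoc, hg, eqToHom_trans_assoc, eqToHom_refl,
      Category.id_comp]⟩
  choose g hg using H
  refine ⟨∑ j, s j ≫ g j, ?_⟩
  rw [Preadditive.sum_comp]
  simp_rw [Category.assoc, hg, ← Category.assoc]
  rw [← Preadditive.sum_comp, hst, Category.id_comp]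

/-- Each indecomposable summand of `Y` is above the cell, so it either kills `L` or belongs to the
cell. -/
lemma addClosure_act (h : IsCellTop R m p G) {a b : C} {F : i ⟶ a} (hF : F ∈ R a) (Y : i ⟶ b)
    (hY : RightLE F Y) : addClosure (cellObjects R L b) ((act i Y).obj L) := by
  revert hY
  refine HasFiatProperties.induction (P := fun Y : i ⟶ b => RightLE F Y →
    addClosure (cellObjects R L b) ((evalFunctor L b).obj Y)) ?_ ?_ ?_ Y
  · intro X hX _
    exact addClosure_of_isZero ((evalFunctor L b).map_isZero hX)
  · intro H hH hFH
    by_cases hz : IsZero ((act i H).obj L)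
    · exact addClosure_of_isZero hz
    · exact addClosure_of_mem ⟨H, h.mem_of_rightLE hF hH hFH hz, rfl⟩
  · intro X Y Z e hY hZ hX
    have hY' := hY (hX.trans_retract ⟨biprod.inl ≫ e.inv, e.hom ≫ biprod.fst, by simp⟩)
    have hZ' := hZ (hX.trans_retract ⟨biprod.inr ≫ e.inv, e.hom ≫ biprod.snd, by simp⟩)
    have := preservesBinaryBiproducts_of_preservesBiproducts (evalFunctor L b)
    exact addClosure_of_iso_biprod
      ((evalFunctor L b).mapIso e ≪≫ (evalFunctor L b).mapBiprod Y Z) hY' hZ'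

lemma addClosure_map (h : IsCellTop R m p G) {a b : C} (H : a ⟶ b) {X : Freyd (i ⟶ a)}
    (hX : addClosure (cellObjects R L a) X) :
    addClosure (cellObjects R L b) ((act i H).obj X) := by
  obtain ⟨n, Y, s, t, hY, hst⟩ := addClosure_iff.1 hX
  refine addClosure_of_sum (fun j => (act i H).obj (Y j)) (fun j => (act i H).map (s j))
    (fun j => (act i H).map (t j)) (fun j => ?_) ?_
  · obtain ⟨F, hF, hFY⟩ := hY j
    refine addClosure_of_retract (Retract.ofIso ?_)
      (h.addClosure_act hF (F ≫ H) ((RightLE.refl F).comp H))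
    exact (act i H).mapIso (eqToIso hFY) ≪≫ (actCompIso F H L).symm
  · simp_rw [← Functor.map_comp]
    rw [← Functor.map_sum, hst, CategoryTheory.Functor.map_id]

lemma isStable (h : IsCellTop R m p G) : IsStable (principal i) (cellSubcategory R L) := by
  rintro a b H X ⟨X₁, X₀, d, q, h₁, h₀, w, ⟨hc⟩⟩
  refine ⟨(act i H).obj X₁, (act i H).obj X₀, (act i H).map d, (act i H).map q,
    h.addClosure_map H h₁, h.addClosure_map H h₀, ?_, ⟨?_⟩⟩
  · exact ((act i H).map_comp d q).symm.trans
      ((congrArg _ w).trans ((act i H).map_zero _ _))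
  · exact isColimitCoforkMapOfIsColimit' (act i H) w hc

variable (k : Type uk) [Field k] [∀ a b : C, Linear k (a ⟶ b)]

lemma isLinearModuleCategory (h : IsCellTop R m p G) (a : C)
    (hfin : ∀ F F' : i ⟶ a, Module.Finite k (F ⟶ F'))
    (hT : ∃ T : Set (i ⟶ a), T.Finite ∧ ∀ F : i ⟶ a, Indecomposable F → ∃ F' ∈ T,
      Nonempty (F ≅ F')) :
    IsLinearModuleCategory k (cellSubcategory R L a).FullSubcategory := by
  obtain ⟨T, hTf, hT⟩ := hT
  have : Finite T := hTf
  obtain ⟨n, ⟨e⟩⟩ := Finite.exists_equiv_fin {t : T // (t : i ⟶ a) ∈ R a}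
  let Y (l : Fin n) : Freyd (i ⟶ a) := (evalFunctor L a).obj (e.symm l : T)
  -- The generator: one summand `F L` for each representative of an indecomposable lying in the
  -- cell.
  let Q : Freyd (i ⟶ a) := ⨁ Y
  have hQ : addClosure (cellObjects R L a) Q :=
    addClosure_of_fintype Y (fun l => biproduct.π Y l) (fun l => biproduct.ι Y l)
      (fun l => ⟨(e.symm l : T), (e.symm l).2, rfl⟩) biproduct.total
  have hret : ∀ Y, cellObjects R L a Y → Nonempty (Retract Y Q) := by
    rintro _ ⟨F, hF, rfl⟩
    have hFi := h.isRightCell.indecomposable hF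
    obtain ⟨t, ht, ⟨f⟩⟩ := hT F hFi
    have hti : Indecomposable t :=
      ⟨fun hz => hFi.1 (hz.of_iso f), fun Y Z f' => hFi.2 Y Z (f ≪≫ f')⟩
    have htR : t ∈ R a := h.isRightCell.mem hF hti
      ((RightLE.refl F).trans_retract (Retract.ofIso f.symm))
      ((RightLE.refl t).trans_retract (Retract.ofIso f))
    have hl : ((e.symm (e ⟨⟨t, ht⟩, htR⟩) : T) : i ⟶ a) = t := by rw [e.symm_apply_apply]
    exact ⟨(Retract.ofIso ((evalFunctor L a).mapIso (f ≪≫ eqToIso hl.symm))).trans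
      ⟨biproduct.ι Y _, biproduct.π Y _, biproduct.ι_π_self Y _⟩⟩
  have hpow : ∀ n : ℕ, addClosure (cellObjects R L a) (⨁ fun _ : Fin n => Q) := fun n =>
    addClosure_of_sum (fun _ => Q) (fun j => biproduct.π _ j) (fun j => biproduct.ι (fun _ => Q) j)
      (fun _ => hQ) biproduct.total
  have hpres : ∀ {X₁ X₀ M : Freyd (i ⟶ a)} {d : X₁ ⟶ X₀} {q : X₀ ⟶ M},
      addClosure (cellObjects R L a) X₁ → addClosure (cellObjects R L a) X₀ →
      IsCokernelOf d q → IsRelativePresentation Q d q := fun {X₁ X₀ M d q} h₁ h₀ hc =>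
    isRelativePresentation_of_isCokernelOf hc (isSummandOfPower_of_addClosure hret h₁)
      (isSummandOfPower_of_addClosure hret h₀) fun {X N} e hX he f => by
        refine h.exists_lift hQ e ?_ f
        obtain ⟨n, s, t, hst⟩ := hX
        exact addClosure_of_sum (fun _ => Q) s t (fun _ => hQ) hst
  let Q' : (cellSubcategory R L a).FullSubcategory := ⟨Q, presentedBy_of_addClosure hQ⟩
  have : Module.Finite k (End Q') :=
    Module.Finite.of_injective ((cellSubcategory R L a).ι.mapLinearMap k :
      (Q' ⟶ Q') →ₗ[k] (Q ⟶ Q)) (cellSubcategory R L a).ι.map_injective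
  refine isLinearModuleCategory_of_presentations (Q := Q') k
    (fun n => ⟨⨁ fun _ : Fin n => Q, presentedBy_of_addClosure (hpow n)⟩) (fun n => ?_)
    (fun M => ?_) fun {m n} d => ?_
  · refine ⟨fun j => ObjectProperty.homMk (biproduct.π (fun _ => Q) j),
      fun j => ObjectProperty.homMk (biproduct.ι (fun _ => Q) j), ?_, fun j l => ?_⟩
    · apply (cellSubcategory R L a).ι.map_injective
      rw [Functor.map_sum]
      exact biproduct.total
    · apply ObjectProperty.hom_ext
      refine (biproduct.ι_π (fun _ => Q) j l).trans ?_
      split_ifs with hjl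
      · rfl
      · rfl
  · obtain ⟨X₁, X₀, d, q, h₁, h₀, hc⟩ := M.property
    exact ⟨⟨X₁, presentedBy_of_addClosure h₁⟩, ⟨X₀, presentedBy_of_addClosure h₀⟩,
      ObjectProperty.homMk d, ObjectProperty.homMk q, .of_hom (hpres h₁ h₀ hc)⟩
  -- The ambient cokernel lies in the subcategory by the very definition of the latter.
  · have hc : IsCokernelOf d.hom (cokernel.π d.hom) :=
      ⟨cokernel.condition _, ⟨cokernelIsCokernel _⟩⟩
    exact ⟨⟨cokernel d.hom, _, _, d.hom, cokernel.π d.hom, hpow m, hpow n, hc⟩,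
      ObjectProperty.homMk (cokernel.π d.hom), .of_hom (hpres (hpow m) (hpow n) hc)⟩

end IsCellTop

end CellCategory

/-! ### Cell data are the minimal submodules -/

section CellDatum

variable {C : Type u} [Bicategory.{w, v} C] [∀ a b : C, Preadditive (a ⟶ b)]
  [IsAdditiveTwoCategory C] [Bicategory.Strict C] [HasFiatProperties C]
  {i : C} {R : ∀ a : C, Set (i ⟶ a)} {L : Freyd (i ⟶ i)} {G : i ⟶ i}

omit [HasFiatProperties C] in
lemma IsCellKernel.of_iso {a : C} {F : i ⟶ a} {K K' : Freyd (i ⟶ i)} {m : K ⟶ unitProj i}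
    (h : IsCellKernel F m) (e : K' ≅ K) : IsCellKernel F (e.hom ≫ m) := by
  have := h.mono
  have := h.isIso
  refine ⟨mono_comp _ _, ?_, fun n hn hi => ?_, ?_⟩
  · rw [Functor.map_comp]
    infer_instance
  · obtain ⟨t, ht⟩ := h.minimal n hn hi
    exact ⟨e.hom ≫ t, by rw [Category.assoc, ht]⟩
  · obtain ⟨F', c, hc⟩ := h.cover
    exact ⟨F', c ≫ e.inv, epi_comp _ _⟩

lemma IsCellKernel.isCellDatum (hR : IsRightCell R) {a : C} {F : i ⟶ a} (hF : F ∈ R a)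
    {K : Subobject (unitProj i)} (h : IsCellKernel F K.arrow)
    (hL : HasSimpleTop (K : Freyd (i ⟶ i)) L) (hG : IsSimpleOf G L) : IsCellDatum R K G L where
  annihilates := by
    rintro Q q ⟨w, ⟨hc⟩⟩ S ⟨hS, Y, n, s, hn, hs⟩ b H hH
    have hq : Epi q := epi_of_isColimit_cofork hc
    have : IsIso ((act i F).map K.arrow) := h.isIso
    have hzero : (act i F).map q = 0 := by
      have : (act i F).map K.arrow ≫ (act i F).map q = 0 :=
        ((act i F).map_comp _ _).symm.trans ((congrArg _ w).trans ((act i F).map_zero _ _))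
      exact (@Preadditive.IsIso.comp_left_eq_zero _ _ _ _ _ _ _ _ ‹_›).1 this
    have hQ : IsZero ((act i H).obj Q) :=
      (hR.rightLE hF hH).isZero_act (IsZero.of_epi_eq_zero _ hzero)
    exact IsZero.of_epi ((act i H).map s) (IsZero.of_mono ((act i H).map n) hQ)
  isSimpleOf := hG
  hasSimpleTop := hL
  not_annihilates b H hH hz := by
    obtain ⟨hS, p, hp, -⟩ := hL
    exact h.not_isZero p (fun h₀ => Simple.not_isZero L (IsZero.of_epi_eq_zero p h₀))
      ((hR.rightLE hH hF).isZero_act hz)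

/-- An exact functor killing every simple subquotient kills the whole quotient, so `F` inverts the
inclusion of `K`; the simple top then forces minimality. Uniqueness of `K` follows. -/
lemma IsCellDatum.isCellKernel {K : Subobject (unitProj i)} (h : IsCellDatum R K G L) {a : C}
    {F : i ⟶ a} (hF : F ∈ R a) : IsCellKernel F K.arrow := by
  obtain ⟨K', m', h'⟩ := exists_isCellKernel F
  refine h'.of_hasSimpleTop K.arrow ?_ h.hasSimpleTop (h.not_annihilates a F hF)
  rw [isIso_map_iff_isZero_cokernel]
  by_contra hz
  obtain ⟨S, hS, hS'⟩ := exists_simpleSubquotient_of_exact (act i F) hz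
  exact hS' (h.annihilates _ (cokernel.π K.arrow)
    ⟨cokernel.condition _, ⟨cokernelIsCokernel _⟩⟩ S hS a F hF)

lemma exists_isCellDatum (hR : IsRightCell R) :
    ∃ (K : Subobject (unitProj i)) (G : i ⟶ i) (L : Freyd (i ⟶ i)), IsCellDatum R K G L := by
  obtain ⟨a, F, hF⟩ := hR.exists_mem
  obtain ⟨K, m, h⟩ := exists_isCellKernel F
  have := h.mono
  have h' := h.of_iso (Subobject.underlyingIso m)
  rw [Subobject.underlyingIso_hom_comp_eq_mk] at h'
  obtain ⟨L, hL⟩ := h'.exists_hasSimpleTop (hR.indecomposable hF)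
  have := hL.1
  obtain ⟨G, hG⟩ := exists_isSimpleOf L
  exact ⟨Subobject.mk m, G, L, h'.isCellDatum hR hF hL hG⟩

lemma IsCellDatum.eq (hR : IsRightCell R) {K K' : Subobject (unitProj i)} {G' : i ⟶ i}
    {L' : Freyd (i ⟶ i)} (h : IsCellDatum R K G L) (h' : IsCellDatum R K' G' L') : K = K' := by
  obtain ⟨a, F, hF⟩ := hR.exists_mem
  have key : ∀ {K K' : Subobject (unitProj i)}, IsCellKernel F K.arrow →
      IsCellKernel F K'.arrow → K ≤ K' := fun {K K'} h h' => by
    obtain ⟨t, ht⟩ := h.minimal K'.arrow inferInstance h'.isIso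
    exact Subobject.le_of_comm t ht
  exact le_antisymm (key (h.isCellKernel hF) (h'.isCellKernel hF))
    (key (h'.isCellKernel hF) (h.isCellKernel hF))

lemma IsCellDatum.exists_isCellTop (hR : IsRightCell R) {K : Subobject (unitProj i)}
    (h : IsCellDatum R K G L) : ∃ p, IsCellTop R K.arrow p G (L := L) := by
  have hL : HasSimpleTop (K : Freyd (i ⟶ i)) L := h.hasSimpleTop
  obtain ⟨-, p, hp, -⟩ := id hL
  exact ⟨p, hR, fun hF => h.isCellKernel hF, hL, hp, h.isSimpleOf⟩

end CellDatum

end CellTwoRep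

end

theorem theorem2 {k : Type uk} [Field k] [IsAlgClosed k]
    {C : Type u} [Bicategory.{w, v} C] [Bicategory.Strict C]
    [∀ a b : C, Preadditive (a ⟶ b)] [∀ a b : C, Linear k (a ⟶ b)] [IsAdditiveTwoCategory C]
    (hC : IsFiat C k) (i : C) (R : ∀ a : C, Set (i ⟶ a)) (hR : IsRightCell R) :
    (∃! K : Subobject (Freyd.proj (𝟙 i)), ∃ (G : i ⟶ i) (L : Freyd (i ⟶ i)),
      IsCellDatum R K G L) ∧
    ∀ (K : Subobject (Freyd.proj (𝟙 i))) (G : i ⟶ i) (L : Freyd (i ⟶ i)),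
      IsCellDatum R K G L →
      (∃ h : IsStable (principal i) (cellSubcategory R L),
        IsTwoRepresentation k (restrict (principal i) (cellSubcategory R L) h)) ∧
      ∀ a : C, IsLinearModuleCategory k (cellSubcategory R L a).FullSubcategory := by
  have := hC.hasFiatProperties
  refine ⟨?_, fun K G L h => ?_⟩
  · obtain ⟨K, G, L, h⟩ := exists_isCellDatum hR
    exact ⟨K, ⟨G, L, h⟩, fun K' ⟨G', L', h'⟩ => IsCellDatum.eq hR h' h⟩
  · obtain ⟨p, h⟩ := IsCellDatum.exists_isCellTop hR h
    have key : ∀ a : C, IsLinearModuleCategory k (cellSubcategory R L a).FullSubcategory :=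
      fun a => h.isLinearModuleCategory k a hC.finite_hom (hC.finite_indecomposable i a)
    refine ⟨⟨h.isStable, fun a => ?_⟩, key⟩
    obtain ⟨S, hS, hS', hfin, e, -⟩ := key a
    exact ⟨S, hS, hS', hfin, ⟨e⟩⟩
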